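/- Let $\mathbb R\langle x\rangle$ be the polynomials in noncommuting variables $x_1,\dots,x_g$ with the involution $^T$ that reverses words and fixes each $x_j$, and let $p=p^T\in\mathbb R\langle x\rangle$. (The degree of a polynomial is the maximal length of its words; the zero polynomial has degree $0$.) Let $p'(x)[h]$ be the coefficient of $t$ in $p(x+th)-p(x)$, and let the Hessian $p''(x)[h]$ be the coefficient of $t$ in $p'(x+th)[h]-p'(x)[h]$. For a $g$-tuple $X$ of real symmetric $n\times n$ matrices and $v\in\mathbb R^n$ put $\mathcal T=\{H\in(\mathbb R^{n\times n}_{sym})^g:\ p'(X)[H]v=0\}$ and let $c_\pm^n(X,v;p)$ be the maximal dimension of a subspace of $\mathcal T$ on which $H\mapsto\langle p''(X)[H]v,v\rangle$ is strictly positive (for $+$), resp. strictly negative (for $-$), for $H\neq0$. Let $\mathcal V(p)=\{(X,v):\ p(X)v=0\}$ ($n\ge1$ arbitrary). Call a set $S=\bigcup_{n\ge1}S_n\subseteq\mathcal V(p)$, with $S_n\subseteq(\mathbb R^{n\times n}_{sym})^g\times\mathbb R^n$, admissible if $S_1\neq\emptyset$ and $S$ respects direct sums, i.e. contains $(\mathrm{diag}(X^1,\dots,X^t),\mathrm{col}(v^1,\dots,v^t))$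 for all finitely many $(X^1,v^1),\dots,(X^t,v^t)\in S$, $t\ge 1$, repetitions allowed. Call $p$ a $0$-minimum degree defining polynomial for $S$ if $S$ is a nonempty subset of $\mathcal V(p)$, every nonzero $q\in\mathbb R\langle x\rangle$ (symmetric or not) with $q(X)v=0$ for all $(X,v)\in S$ has $\deg q\ge\deg p$, and some $q\in\mathbb R\langle x\rangle$ of degree $\deg p$ satisfies $q(X)v=0$ for all $(X,v)\in S$. Call $p$ convex if $p(tX+(1-t)Y)\preceq t\,p(X)+(1-t)\,p(Y)$ for all $n$, all $g$-tuples $X,Y$ of symmetric $n\times n$ matrices and all $0\le t\le1$, and concave if $-p$ is convex. **Theorem.** (A) (i) If $S$ is admissible, then for every $n\ge1$ and each sign the supremum below is finite, and the limits $$C_\pm(S)=\lim_{n\to\infty}\ \sup\Big\{\frac{c_\pm^n(X,v;p)}{n}:\ (X,v)\in S_n\Big\}$$ exist and are finite. (ii) If moreover $p$ is a $0$-minimum degree defining polynomial for $S$, then $\deg p\le 2C_+(S)+2$ and $\deg p\le 2C_-(S)+2$. (B) Let $S$ be admissible and $p$ a $0$-minimum degree defining polynomial for $S$. If $C_-(S)=0$,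 then $p$ is convex of degree at most $2$; if $C_+(S)=0$, then $p$ is concave of degree at most $2$. (C) Conversely, if $p$ is convex (resp. concave), then $\deg p\le2$ and $c_-^n(X,v;p)=0$ (resp. $c_+^n(X,v;p)=0$) for every $n$, every $X\in(\mathbb R^{n\times n}_{sym})^g$ and every $v\in\mathbb R^n$. (D) If $S$ and $S'$ are admissible and $p$ is a $0$-minimum degree defining polynomial for each of them, then $C_+(S)=C_+(S')$ and $C_-(S)=C_-(S')$. Moreover, with $V(x)[h]$ the column of all $h_jw(x)$, $1\le j\le g$, $w$ a word of length at most $\deg p-2$ (the empty column if $\deg p\le1$), the Hessian has a representation $p''(x)[h]=V(x)[h]^TZ(x)V(x)[h]$ with $Z$ a square matrix over $\mathbb R\langle x\rangle$; and for every such $Z$, every admissible $S$ for which $p$ is a $0$-minimum degree defining polynomial has $C_\pm(S)=\mu_\pm(Z(0))$, the number of positive (resp. negative) eigenvalues of $Z(0)$, counted with multiplicity. -/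

import Mathlib

open scoped Matrix

noncomputable section

namespace NCSignature

/-- `ℝ⟨x₁,…,x_g⟩`: polynomials with real coefficients in `g` noncommuting variables.
Its `star` is the involution that fixes every `x_j` and reverses words, so that the
symmetric polynomials are those with `star p = p`. -/
abbrev NCPoly (g : ℕ) : Type := FreeAlgebra ℝ (Fin g)

/-- `ℝ⟨x,h⟩`: polynomials in the `2g` noncommuting variables `x_j` (`Sum.inl j`) and
`h_j` (`Sum.inr j`). -/
abbrev NCPolyXH (g : ℕ) : Type := FreeAlgebra ℝ (Fin g ⊕ Fin g)

/-- The degree: the maximal length of a word that occurs with nonzero coefficient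
(with the convention that the zero polynomial has degree `0`). -/
def ncDegree {g : ℕ} (p : NCPoly g) : ℕ :=
  ((FreeAlgebra.basisFreeMonoid ℝ (Fin g)).repr p).support.sup FreeMonoid.length

/-- The inclusion `ℝ⟨x⟩ → ℝ⟨x,h⟩`. -/
def inclX (g : ℕ) : NCPoly g →ₐ[ℝ] NCPolyXH g :=
  FreeAlgebra.lift ℝ fun j => FreeAlgebra.ι ℝ (Sum.inl j)

/-- The substitution `x ↦ x + t h`, `h ↦ h`, where `t` is a commuting indeterminate. -/
def shiftX (g : ℕ) : NCPolyXH g →ₐ[ℝ] Polynomial (NCPolyXH g) :=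
  FreeAlgebra.lift ℝ (Sum.elim
    (fun j => Polynomial.C (FreeAlgebra.ι ℝ (Sum.inl j)) +
      Polynomial.X * Polynomial.C (FreeAlgebra.ι ℝ (Sum.inr j)))
    (fun j => Polynomial.C (FreeAlgebra.ι ℝ (Sum.inr j))))

/-- The directional derivative of `q(x)[h]` with respect to `x` in the direction `h`: the
coefficient of `t` in `q(x + t h)[h] - q(x)[h]`. -/
def dirDeriv {g : ℕ} (q : NCPolyXH g) : NCPolyXH g :=
  (shiftX g q - Polynomial.C q).coeff 1

/-- The first derivative `p'(x)[h]`. -/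
def ncDeriv {g : ℕ} (p : NCPoly g) : NCPolyXH g := dirDeriv (inclX g p)

/-- The Hessian `p''(x)[h]`. -/
def ncHessian {g : ℕ} (p : NCPoly g) : NCPolyXH g := dirDeriv (ncDeriv p)

/-- `g`-tuples of real `n × n` matrices. -/
abbrev MatTuple (g n : ℕ) : Type := Fin g → Matrix (Fin n) (Fin n) ℝ

/-- `g`-tuples of real symmetric `n × n` matrices. -/
def IsSymmTuple {g n : ℕ} (X : MatTuple g n) : Prop := ∀ j, (X j).IsSymm

/-- The evaluation `p(X)`. -/
def evalX {g n : ℕ} (p : NCPoly g) (X : MatTuple g n) : Matrix (Fin n) (Fin n) ℝ :=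
  FreeAlgebra.lift ℝ X p

/-- The evaluation `f(X)[H]`. -/
def evalXH {g n : ℕ} (f : NCPolyXH g) (X H : MatTuple g n) : Matrix (Fin n) (Fin n) ℝ :=
  FreeAlgebra.lift ℝ (Sum.elim X H) f

/-- Matrix convexity: `p(tX + (1-t)Y) ⪯ t p(X) + (1-t) p(Y)` for all symmetric tuples
`X, Y` of every size and all `0 ≤ t ≤ 1`. -/
def IsMatrixConvex {g : ℕ} (p : NCPoly g) : Prop :=
  ∀ (n : ℕ) (X Y : MatTuple g n), IsSymmTuple X → IsSymmTuple Y →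
    ∀ t : ℝ, 0 ≤ t → t ≤ 1 →
      (t • evalX p X + (1 - t) • evalX p Y - evalX p (t • X + (1 - t) • Y)).PosSemidef

/-- Matrix concavity. -/
def IsMatrixConcave {g : ℕ} (p : NCPoly g) : Prop := IsMatrixConvex (-p)

/-- A graded set of pairs `(X, v)`: for each `n`, a set of pairs of a `g`-tuple of
`n × n` matrices and a vector of `ℝⁿ`. Only the levels `n ≥ 1` matter. -/
abbrev GradedSet (g : ℕ) : Type := ∀ n : ℕ, Set (MatTuple g n × (Fin n → ℝ))

/-- The variety `𝒱(p)`: pairs `(X, v)` with `X` symmetric and `p(X) v = 0`. -/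
def ncVariety {g : ℕ} (p : NCPoly g) : GradedSet g :=
  fun _ => {P | IsSymmTuple P.1 ∧ evalX p P.1 *ᵥ P.2 = 0}

/-- `diag(X¹, …, Xᵗ)`. -/
def diagSum {g t : ℕ} {n : Fin t → ℕ} (X : ∀ i, MatTuple g (n i)) :
    MatTuple g (∑ i, n i) :=
  fun j => Matrix.reindex finSigmaFinEquiv finSigmaFinEquiv
    (Matrix.blockDiagonal' fun i => X i j)

/-- `col(v¹, …, vᵗ)`. -/
def colSum {t : ℕ} {n : Fin t → ℕ} (v : ∀ i, Fin (n i) → ℝ) : Fin (∑ i, n i) → ℝ :=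
  fun k => v (finSigmaFinEquiv.symm k).1 (finSigmaFinEquiv.symm k).2

/-- `S` respects direct sums: the direct sum of any nonempty finite family of members
(repetitions allowed) is again a member. -/
def RespectsDirectSums {g : ℕ} (S : GradedSet g) : Prop :=
  ∀ (t : ℕ) (n : Fin t → ℕ) (X : ∀ i, MatTuple g (n i)) (v : ∀ i, Fin (n i) → ℝ),
    0 < t → (∀ i, 0 < n i) → (∀ i, (X i, v i) ∈ S (n i)) →
      (diagSum X, colSum v) ∈ S (∑ i, n i)

/-- `S` is contained in `𝒱(p)`, respects direct sums, and has a point at level `1`. -/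
structure IsAdmissible {g : ℕ} (p : NCPoly g) (S : GradedSet g) : Prop where
  subset : ∀ n, 1 ≤ n → S n ⊆ ncVariety p n
  directSums : RespectsDirectSums S
  nonempty_one : (S 1).Nonempty

/-- `q(X) v = 0` for every `(X, v) ∈ S`. -/
def VanishesOn {g : ℕ} (q : NCPoly g) (S : GradedSet g) : Prop :=
  ∀ n, 1 ≤ n → ∀ P ∈ S n, evalX q P.1 *ᵥ P.2 = 0

/-- `p` is a `k`-minimum degree defining polynomial for `S`. -/
structure IsMinDegreeDefining {g : ℕ} (k : ℕ) (p : NCPoly g) (S : GradedSet g) : Prop where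
  symmetric : star p = p
  nonempty : ∃ n, 1 ≤ n ∧ (S n).Nonempty
  subset : ∀ n, 1 ≤ n → S n ⊆ ncVariety p n
  le_degree : ∀ q : NCPoly g, q ≠ 0 → VanishesOn q S →
    (ncDegree p : ℤ) - k ≤ ncDegree q
  attained : ∃ q : NCPoly g, (ncDegree q : ℤ) = ncDegree p - k ∧ VanishesOn q S

/-- `𝒯 = {H symmetric : p'(X)[H] v = 0}`, the clamped tangent plane if `(X, v) ∈ 𝒱(p)`. -/
def clampedTangent {g n : ℕ} (p : NCPoly g) (X : MatTuple g n) (v : Fin n → ℝ) :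
    Set (MatTuple g n) :=
  {H | IsSymmTuple H ∧ evalXH (ncDeriv p) X H *ᵥ v = 0}

/-- The quadratic form `H ↦ ⟨f(X)[H] v, v⟩`. -/
def quadForm {g n : ℕ} (f : NCPolyXH g) (X : MatTuple g n) (v : Fin n → ℝ)
    (H : MatTuple g n) : ℝ :=
  (evalXH f X H *ᵥ v) ⬝ᵥ v

/-- `e₊ⁿ(X, v; f, 𝓗)`: the maximal dimension of a subspace of `𝓗` on which the quadratic
form `⟨f(X)[H] v, v⟩` is strictly positive (away from `H = 0`). -/
def ePos {g n : ℕ} (X : MatTuple g n) (v : Fin n → ℝ) (f : NCPolyXH g)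
    (𝓗 : Set (MatTuple g n)) : ℕ :=
  sSup {k | ∃ W : Submodule ℝ (MatTuple g n), (W : Set (MatTuple g n)) ⊆ 𝓗 ∧
    (∀ H ∈ W, H ≠ 0 → 0 < quadForm f X v H) ∧ Module.finrank ℝ W = k}

/-- `e₋ⁿ(X, v; f, 𝓗)`: the maximal dimension of a subspace of `𝓗` on which the quadratic
form `⟨f(X)[H] v, v⟩` is strictly negative (away from `H = 0`). -/
def eNeg {g n : ℕ} (X : MatTuple g n) (v : Fin n → ℝ) (f : NCPolyXH g)
    (𝓗 : Set (MatTuple g n)) : ℕ :=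
  sSup {k | ∃ W : Submodule ℝ (MatTuple g n), (W : Set (MatTuple g n)) ⊆ 𝓗 ∧
    (∀ H ∈ W, H ≠ 0 → quadForm f X v H < 0) ∧ Module.finrank ℝ W = k}

/-- `c₊ⁿ(X, v; p)`. -/
def cPos {g n : ℕ} (p : NCPoly g) (X : MatTuple g n) (v : Fin n → ℝ) : ℕ :=
  ePos X v (ncHessian p) (clampedTangent p X v)

/-- `c₋ⁿ(X, v; p)`. -/
def cNeg {g n : ℕ} (p : NCPoly g) (X : MatTuple g n) (v : Fin n → ℝ) : ℕ :=
  eNeg X v (ncHessian p) (clampedTangent p X v)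

/-- `C₊(S) = C`: for every `n ≥ 1` the set `{c₊ⁿ(X, v; p) / n : (X, v) ∈ S_n}` has a
(finite) supremum `β n`, and `β n → C`. -/
def IsCurvPos {g : ℕ} (p : NCPoly g) (S : GradedSet g) (C : ℝ) : Prop :=
  ∃ β : ℕ → ℝ,
    (∀ n : ℕ, 1 ≤ n → IsLUB ((fun P => (cPos p P.1 P.2 : ℝ) / (n : ℝ)) '' S n) (β n)) ∧
    Filter.Tendsto β Filter.atTop (nhds C)

/-- `C₋(S) = C`: for every `n ≥ 1` the set `{c₋ⁿ(X, v; p) / n : (X, v) ∈ S_n}` has a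
(finite) supremum `β n`, and `β n → C`. -/
def IsCurvNeg {g : ℕ} (p : NCPoly g) (S : GradedSet g) (C : ℝ) : Prop :=
  ∃ β : ℕ → ℝ,
    (∀ n : ℕ, 1 ≤ n → IsLUB ((fun P => (cNeg p P.1 P.2 : ℝ) / (n : ℝ)) '' S n) (β n)) ∧
    Filter.Tendsto β Filter.atTop (nhds C)

/-- Indices of the border vector: pairs `(j, w)` with `w` a word in `x₁,…,x_g` of length
at most `d - 2` (no such pairs if `d ≤ 1`). -/
abbrev BorderIdx (g d : ℕ) : Type := Fin g × (Σ k : Fin (d - 1), Fin k → Fin g)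

/-- The entry `h_j w(x)` of the border vector. -/
def border {g d : ℕ} (I : BorderIdx g d) : NCPolyXH g :=
  FreeAlgebra.ι ℝ (Sum.inr I.1) *
    ((List.ofFn I.2.2).map fun i => FreeAlgebra.ι ℝ (Sum.inl i : Fin g ⊕ Fin g)).prod

/-- `Z(x)` is the middle matrix of the Hessian of `p`:
`p''(x)[h] = V(x)[h]ᵀ Z(x) V(x)[h]`, with `V` the border vector for the degree of `p`. -/
def IsMiddleMatrix {g : ℕ} (p : NCPoly g)
    (Z : Matrix (BorderIdx g (ncDegree p)) (BorderIdx g (ncDegree p)) (NCPoly g)) : Prop :=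
  ncHessian p = ∑ I, ∑ J, star (border I) * inclX g (Z I J) * border J

/-- The scalar matrix `Z(0)`. -/
def scalarPart {g : ℕ} {m : Type} (Z : Matrix m m (NCPoly g)) : Matrix m m ℝ :=
  Z.map (FreeAlgebra.lift ℝ fun _ : Fin g => (0 : ℝ))

/-- `μ₊(A)`: the number of positive eigenvalues, counted with multiplicity. -/
def muPos {m : Type} [Fintype m] [DecidableEq m] (A : Matrix m m ℝ) : ℕ :=
  Multiset.card (A.charpoly.roots.filter (0 < ·))

/-- `μ₋(A)`: the number of negative eigenvalues, counted with multiplicity. -/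
def muNeg {m : Type} [Fintype m] [DecidableEq m] (A : Matrix m m ℝ) : ℕ :=
  Multiset.card (A.charpoly.roots.filter (· < 0))

end NCSignature

end

/-!
# The signature of the Hessian on a noncommutative variety

Write the Hessian of `p` as `p''(x)[h] = V* Z(x) V` with border vector `V` of entries `h_j w`. The
entry of `Z` at `(h_i w', h_j w)` collects twice the words `m` with `w'ᵀ x_i m x_j w` in `p`
(`middleMatrix`), and `Z(0)` can be read off from the Hessian (`scalarPart_eq_of_hessian`).
Splitting off the first letter of `m` gives `(1 - N) Z = Z(0)` with `N` nilpotent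
(`sub_shiftMatrix_mul_middleMatrix`). As `Z` and `Z(0)` are self-adjoint, `C = (1 - N)^{1/2}`
satisfies `C Z C* = Z(0)` (`exists_congruence`), so that `Z` is congruent over `ℝ⟨x⟩` to the
diagonal form of `Z(0)`, and `⟨p''(X)[H] v, v⟩ = ∑ l_k |y_k|²` where the vectors `y_k ∈ ℝⁿ`
depend linearly on `H` and the weights `l_k` have the signature of `Z(0)` (`quadForm_hessian`).

Hence `c₊ⁿ ≤ n μ₊(Z(0))` (`cPos_le`). Conversely, if the vectors `w(X) v` with `w` of length less
than `d = deg p` are independent, then a symmetric `H` can be found with prescribed values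
`H_j w(X) v`, up to a number of linear conditions that does not depend on `n`; the values at
words `w` of length `d - 1` serve to solve `p'(X)[H] v = 0`. This gives
`n μ₊(Z(0)) ≤ c₊ⁿ + const` (`le_cPos_add`). When no nonzero polynomial of degree less than `d`
vanishes on `S`, such a point exists in `S` (`exists_indepWords`), and so do its multiples.
Since `c₊` is superadditive under direct sums, the limit `C₊(S)` exists by Fekete's lemma
(`exists_isCurvPos`), and it equals `μ₊(Z(0))` (`isCurvPos_eq`). The other sign follows by passing
to `-p`.

The matrix `Z(0)` is block anti-triangular with nonzero blocks on the anti-diagonal, which forces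
`d ≤ 2 μ_±(Z(0)) + 2` (`ncDegree_le_mu`). Finally `p` is convex exactly if its Hessian is
nonnegative, as the Hessian is the second derivative along lines; and at a point of Fock space
type with independent words the lower bound turns convexity into `μ₋(Z(0)) = 0`
(`IsMatrixConvex.degree_le_two`).
-/

noncomputable section

namespace NCSignature

/-! ### Words, coefficients and degree -/

section Words
variable {α : Type*}

/-- The monomial of a word. -/
def mon (w : List α) : FreeAlgebra ℝ α := (w.map (FreeAlgebra.ι ℝ)).prod

/-- The coefficient of a word, as a linear functional. -/
def coef (w : List α) : FreeAlgebra ℝ α →ₗ[ℝ] ℝ :=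
  (FreeAlgebra.basisFreeMonoid ℝ α).coord (FreeMonoid.ofList w)

@[simp] lemma mon_nil : mon ([] : List α) = 1 := by simp [mon]

lemma mon_cons (a : α) (w : List α) : mon (a :: w) = FreeAlgebra.ι ℝ a * mon w := by simp [mon]

lemma mon_append (u w : List α) : mon (u ++ w) = mon u * mon w := by simp [mon]

lemma mon_singleton (a : α) : mon [a] = FreeAlgebra.ι ℝ a := by simp [mon]

lemma basisFreeMonoid_apply (w : List α) :
    FreeAlgebra.basisFreeMonoid ℝ α (FreeMonoid.ofList w) = mon w := by
  simp only [FreeAlgebra.basisFreeMonoid, mon]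
  simp [FreeAlgebra.equivMonoidAlgebraFreeMonoid, FreeMonoid.lift_apply]

lemma coef_mon [DecidableEq α] (u w : List α) : coef u (mon w) = if u = w then 1 else 0 := by
  classical
  rw [← basisFreeMonoid_apply, coef, Module.Basis.coord_apply, Module.Basis.repr_self,
    Finsupp.single_apply]
  simp [eq_comm]

/-- Two linear maps that agree on all monomials are equal. -/
lemma linearMap_ext_mon {M : Type*} [AddCommMonoid M] [Module ℝ M]
    {f f' : FreeAlgebra ℝ α →ₗ[ℝ] M} (h : ∀ w, f (mon w) = f' (mon w)) : f = f' :=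
  (FreeAlgebra.basisFreeMonoid ℝ α).ext fun w => by
    have := h w.toList
    rwa [← basisFreeMonoid_apply] at this

lemma ext_coef {p q : FreeAlgebra ℝ α} (h : ∀ w, coef w p = coef w q) : p = q :=
  (FreeAlgebra.basisFreeMonoid ℝ α).ext_elem fun w => h w.toList

lemma coef_ι_mul [DecidableEq α] (a : α) (u : List α) (q : FreeAlgebra ℝ α) :
    coef u (FreeAlgebra.ι ℝ a * q) = if u.head? = some a then coef u.tail q else 0 := by
  have : (coef u) ∘ₗ (LinearMap.mulLeft ℝ (FreeAlgebra.ι ℝ a)) =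
      if u.head? = some a then coef u.tail else 0 := by
    refine linearMap_ext_mon fun w => ?_
    rw [LinearMap.comp_apply, LinearMap.mulLeft_apply, ← mon_cons, coef_mon]
    cases u with
    | nil => simp
    | cons b u => by_cases hb : b = a <;> simp [hb, coef_mon]
  have := congrArg (fun f => f q) this
  simp only [LinearMap.comp_apply, LinearMap.mulLeft_apply] at this
  rw [this]
  split_ifs <;> rfl

lemma coef_algebraMap (w : List α) (c : ℝ) :
    coef w (algebraMap ℝ (FreeAlgebra ℝ α) c) = if w = [] then c else 0 := by
  classical
  rw [Algebra.algebraMap_eq_smul_one, ← mon_nil, map_smul, coef_mon]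
  simp

lemma star_mon (w : List α) : star (mon w) = mon w.reverse := by
  induction w with
  | nil => simp
  | cons a w ih => rw [mon_cons, star_mul, ih, FreeAlgebra.star_ι, List.reverse_cons, mon_append,
      mon_singleton]

lemma star_smul' (c : ℝ) (q : FreeAlgebra ℝ α) : star (c • q) = c • star q := by
  rw [Algebra.smul_def, star_mul, FreeAlgebra.star_algebraMap, Algebra.smul_def, Algebra.commutes]

lemma coef_star (w : List α) (q : FreeAlgebra ℝ α) : coef w (star q) = coef w.reverse q := by
  classical
  let s : FreeAlgebra ℝ α →ₗ[ℝ] FreeAlgebra ℝ α :=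
    { toFun := star, map_add' := star_add, map_smul' := fun c q => star_smul' c q }
  have : (coef w) ∘ₗ s = coef w.reverse := by
    refine linearMap_ext_mon fun u => ?_
    change coef w (star (mon u)) = _
    rw [star_mon, coef_mon, coef_mon]
    congr 1
    exact propext (List.reverse_eq_iff.symm)
  exact congrArg (fun f => f q) this

lemma coef_lift_zero (q : FreeAlgebra ℝ α) :
    FreeAlgebra.lift ℝ (fun _ : α => (0 : ℝ)) q = coef [] q := by
  classical
  have : (FreeAlgebra.lift ℝ (fun _ : α => (0 : ℝ))).toLinearMap = coef [] := by
    refine linearMap_ext_mon fun u => ?_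
    rw [coef_mon]
    cases u with
    | nil => simp
    | cons a u => simp [mon_cons]
  exact congrArg (fun f => f q) this

/-- `strip u w p` is the sum of all `c m` such that the word `u m w` occurs in `p` with
coefficient `c`. -/
def strip (u w : List α) : FreeAlgebra ℝ α →ₗ[ℝ] FreeAlgebra ℝ α :=
  (FreeAlgebra.basisFreeMonoid ℝ α).repr.symm.toLinearMap ∘ₗ
    Finsupp.lcomapDomain
      (fun m : FreeMonoid α => FreeMonoid.ofList u * m * FreeMonoid.ofList w)
      (fun m m' h => by simpa using h) ∘ₗ (FreeAlgebra.basisFreeMonoid ℝ α).repr.toLinearMap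

lemma coef_strip (u w m : List α) (p : FreeAlgebra ℝ α) :
    coef m (strip u w p) = coef (u ++ m ++ w) p := by
  simp only [coef, strip, Module.Basis.coord_apply]
  simp [Finsupp.lcomapDomain, mul_assoc]

lemma strip_strip (u w u' w' : List α) (p : FreeAlgebra ℝ α) :
    strip u' w' (strip u w p) = strip (u ++ u') (w' ++ w) p :=
  ext_coef fun m => by simp [coef_strip]

lemma strip_nil (p : FreeAlgebra ℝ α) : strip [] [] p = p :=
  ext_coef fun m => by simp [coef_strip]

lemma star_strip (u w : List α) (p : FreeAlgebra ℝ α) :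
    star (strip u w p) = strip w.reverse u.reverse (star p) :=
  ext_coef fun m => by simp [coef_strip, coef_star]

lemma eq_add_sum_ι_mul [Fintype α] (q : FreeAlgebra ℝ α) :
    q = algebraMap ℝ _ (coef [] q) + ∑ a, FreeAlgebra.ι ℝ a * strip [a] [] q := by
  classical
  refine ext_coef fun w => ?_
  rw [map_add, map_sum, coef_algebraMap]
  cases w with
  | nil => simp [coef_ι_mul]
  | cons b w =>
    simp [coef_ι_mul, coef_strip]

lemma eq_add_sum_mul_ι [Fintype α] (q : FreeAlgebra ℝ α) :
    q = algebraMap ℝ _ (coef [] q) + ∑ a, strip [] [a] q * FreeAlgebra.ι ℝ a := by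
  have h := congrArg star (eq_add_sum_ι_mul (star q))
  simpa [star_sum, star_strip, coef_star] using h

end Words

variable {g : ℕ}

lemma coef_eq_zero_of_ncDegree_lt {p : NCPoly g} {w : List (Fin g)} (h : ncDegree p < w.length) :
    coef w p = 0 := by
  by_contra hne
  have : FreeMonoid.ofList w ∈ ((FreeAlgebra.basisFreeMonoid ℝ (Fin g)).repr p).support := by
    simpa [coef] using hne
  exact absurd (Finset.le_sup (f := FreeMonoid.length) this) (not_le.2 h)

lemma ncDegree_le_iff {p : NCPoly g} {d : ℕ} :
    ncDegree p ≤ d ↔ ∀ w : List (Fin g), d < w.length → coef w p = 0 := by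
  refine ⟨fun h w hw => coef_eq_zero_of_ncDegree_lt (h.trans_lt hw), fun h => ?_⟩
  refine Finset.sup_le fun w hw => ?_
  by_contra hlt
  exact (Finsupp.mem_support_iff.1 hw) (h w.toList (not_le.1 hlt))

lemma exists_coef_ne_zero_of_ncDegree_pos {p : NCPoly g} (h : 0 < ncDegree p) :
    ∃ w : List (Fin g), w.length = ncDegree p ∧ coef w p ≠ 0 := by
  by_contra! hc
  have : ncDegree p ≤ ncDegree p - 1 := ncDegree_le_iff.2 fun w hw => by
    rcases eq_or_lt_of_le (Nat.succ_le_of_lt hw) with h1 | h1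
    · exact hc w (by omega)
    · exact coef_eq_zero_of_ncDegree_lt (by omega)
  omega

lemma eq_algebraMap_of_coef {α : Type*} {p : FreeAlgebra ℝ α}
    (h : ∀ w : List α, w ≠ [] → coef w p = 0) :
    p = algebraMap ℝ _ (coef [] p) :=
  ext_coef fun w => by
    rw [coef_algebraMap]
    split_ifs with hw
    · rw [hw]
    · exact h w hw

/-! ### Derivatives and the middle matrix -/

section Derivatives

variable {g : ℕ}

lemma shiftX_coeff_zero (f : NCPolyXH g) : (shiftX g f).coeff 0 = f := by
  refine FreeAlgebra.induction ℝ (Fin g ⊕ Fin g)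
    (motive := fun f => (shiftX g f).coeff 0 = f) ?_ ?_ ?_ ?_ f
  · intro r; rw [AlgHom.commutes, Polynomial.algebraMap_apply, Polynomial.coeff_C_zero]
  · rintro (j | j) <;> simp [shiftX]
  · intro a b ha hb; rw [map_mul, Polynomial.mul_coeff_zero, ha, hb]
  · intro a b ha hb; rw [map_add, Polynomial.coeff_add, ha, hb]

lemma dirDeriv_eq (f : NCPolyXH g) : dirDeriv f = (shiftX g f).coeff 1 := by
  simp [dirDeriv]

lemma dirDeriv_add (f f' : NCPolyXH g) : dirDeriv (f + f') = dirDeriv f + dirDeriv f' := by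
  simp [dirDeriv_eq]

lemma dirDeriv_neg (f : NCPolyXH g) : dirDeriv (-f) = -dirDeriv f := by
  simp [dirDeriv_eq]

lemma dirDeriv_mul (f f' : NCPolyXH g) :
    dirDeriv (f * f') = dirDeriv f * f' + f * dirDeriv f' := by
  simp only [dirDeriv_eq, map_mul, Polynomial.coeff_mul, Finset.Nat.antidiagonal_succ]
  simp [shiftX_coeff_zero, add_comm]

lemma dirDeriv_algebraMap (r : ℝ) : dirDeriv (algebraMap ℝ (NCPolyXH g) r) = 0 := by
  rw [dirDeriv_eq, AlgHom.commutes, Polynomial.algebraMap_apply]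
  simp

lemma dirDeriv_inl (j : Fin g) :
    dirDeriv (FreeAlgebra.ι ℝ (Sum.inl j) : NCPolyXH g) = FreeAlgebra.ι ℝ (Sum.inr j) := by
  simp [dirDeriv_eq, shiftX, Polynomial.coeff_C]

lemma dirDeriv_inr (j : Fin g) :
    dirDeriv (FreeAlgebra.ι ℝ (Sum.inr j) : NCPolyXH g) = 0 := by
  simp [dirDeriv_eq, shiftX]

lemma dirDeriv_sum {ι : Type*} (s : Finset ι) (f : ι → NCPolyXH g) :
    dirDeriv (∑ i ∈ s, f i) = ∑ i ∈ s, dirDeriv (f i) :=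
  map_sum (AddMonoidHom.mk' dirDeriv dirDeriv_add) f s

/-- The variable `h_j`. -/
abbrev hVar (j : Fin g) : NCPolyXH g := FreeAlgebra.ι ℝ (Sum.inr j)

lemma inclX_ι (j : Fin g) : inclX g (FreeAlgebra.ι ℝ j) = FreeAlgebra.ι ℝ (Sum.inl j) := by
  simp [inclX]

lemma inclX_mon (w : List (Fin g)) : inclX g (mon w) = mon (w.map Sum.inl) := by
  induction w with
  | nil => simp
  | cons a w ih => rw [mon_cons, map_mul, ih, inclX_ι, List.map_cons, mon_cons]

lemma ncDeriv_neg (p : NCPoly g) : ncDeriv (-p) = -ncDeriv p := by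
  simp [ncDeriv, dirDeriv_neg]

lemma ncHessian_neg (p : NCPoly g) : ncHessian (-p) = -ncHessian p := by
  simp [ncHessian, ncDeriv_neg, dirDeriv_neg]

lemma ncDeriv_algebraMap (c : ℝ) : ncDeriv (algebraMap ℝ (NCPoly g) c) = 0 := by
  rw [ncDeriv, AlgHom.commutes, dirDeriv_algebraMap]

lemma ncDeriv_rightStrip (q : NCPoly g) :
    ncDeriv q = ∑ j, (inclX g (strip [] [j] q) * hVar j) +
      ∑ j, ncDeriv (strip [] [j] q) * inclX g (mon [j]) := by
  conv_lhs => rw [eq_add_sum_mul_ι q]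
  simp only [ncDeriv, map_add, map_sum, map_mul, AlgHom.commutes, dirDeriv_add, dirDeriv_sum,
    dirDeriv_mul, dirDeriv_algebraMap, inclX_ι, dirDeriv_inl, mon_singleton,
    Finset.sum_add_distrib]
  rw [zero_add, add_comm]

lemma ncDeriv_leftStrip (q : NCPoly g) :
    ncDeriv q = ∑ j, (hVar j * inclX g (strip [j] [] q)) +
      ∑ j, inclX g (mon [j]) * ncDeriv (strip [j] [] q) := by
  conv_lhs => rw [eq_add_sum_ι_mul q]
  simp only [ncDeriv, map_add, map_sum, map_mul, AlgHom.commutes, dirDeriv_add, dirDeriv_sum,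
    dirDeriv_mul, dirDeriv_algebraMap, inclX_ι, dirDeriv_inl, mon_singleton,
    Finset.sum_add_distrib]
  rw [zero_add]

lemma ncHessian_rightStrip (q : NCPoly g) :
    ncHessian q = ∑ j, (2 : ℝ) • (ncDeriv (strip [] [j] q) * hVar j) +
      ∑ j, ncHessian (strip [] [j] q) * inclX g (mon [j]) := by
  rw [ncHessian, ncDeriv_rightStrip q]
  have h1 : ∀ r : NCPoly g, dirDeriv (inclX g r) = ncDeriv r := fun _ => rfl
  have h2 : ∀ r : NCPoly g, dirDeriv (ncDeriv r) = ncHessian r := fun _ => rfl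
  simp only [dirDeriv_add, dirDeriv_sum, dirDeriv_mul, inclX_ι, dirDeriv_inl, dirDeriv_inr,
    mon_singleton, Finset.sum_add_distrib, h1, h2, mul_zero, add_zero, two_smul]
  abel

/-- Words of length less than `m`. -/
abbrev Words (g m : ℕ) : Type := Σ k : Fin m, Fin k → Fin g

/-- The list of letters of a word. -/
def letters {g m : ℕ} (w : Words g m) : List (Fin g) := List.ofFn w.2

@[simp] lemma length_letters {m : ℕ} (w : Words g m) : (letters w).length = w.1 := by
  simp [letters]

lemma length_letters_lt {m : ℕ} (w : Words g m) : (letters w).length < m := by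
  simp

lemma letters_injective {m : ℕ} : Function.Injective (letters : Words g m → List (Fin g)) := by
  rintro ⟨⟨k, hk⟩, w⟩ ⟨⟨k', hk'⟩, w'⟩ h
  have hl := congrArg List.length h
  simp only [length_letters] at hl
  subst hl
  simp only [letters] at h
  rw [List.ofFn_injective h]

lemma exists_letters {m : ℕ} {l : List (Fin g)} (h : l.length < m) :
    ∃ w : Words g m, letters w = l :=
  ⟨⟨⟨l.length, h⟩, l.get⟩, List.ofFn_get l⟩

/-- Unfolding a recursion over words: if `A w = T w + ∑ j, A (j w)`, then `A` of the empty word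
is the sum of `T` over all words of length less than `m` and of `A` over those of length `m`. -/
lemma unfold_words {M : Type*} [AddCommMonoid M] (A T : List (Fin g) → M)
    (h : ∀ w, A w = T w + ∑ j, A (j :: w)) (m : ℕ) :
    A [] = ∑ w : Words g m, T (letters w) + ∑ w : Fin m → Fin g, A (List.ofFn w) := by
  induction m with
  | zero => simp
  | succ m ih =>
    rw [ih, Fintype.sum_sigma, Fintype.sum_sigma, Fin.sum_univ_castSucc, add_assoc]
    simp only [letters]
    congr 1
    simp only [Fin.val_last]
    rw [Finset.sum_congr rfl fun w _ => h (List.ofFn w), Finset.sum_add_distrib]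
    congr 1
    rw [← (Fin.consEquiv fun _ => Fin g).sum_comp, Fintype.sum_prod_type, Finset.sum_comm]
    refine Finset.sum_congr rfl fun w _ => Finset.sum_congr rfl fun j _ => ?_
    simp [Fin.consEquiv, List.ofFn_succ]

lemma ncDeriv_eq_right (p : NCPoly g) (m : ℕ) :
    ncDeriv p = ∑ w : Words g m, ∑ j,
        inclX g (strip [] (j :: letters w) p) * hVar j * inclX g (mon (letters w)) +
      ∑ w : Fin m → Fin g, ncDeriv (strip [] (List.ofFn w) p) * inclX g (mon (List.ofFn w)) := by
  have := unfold_words (fun w => ncDeriv (strip [] w p) * inclX g (mon w))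
    (fun w => ∑ j, inclX g (strip [] (j :: w) p) * hVar j * inclX g (mon w)) (fun w => by
      rw [ncDeriv_rightStrip]
      simp only [add_mul, Finset.sum_mul, strip_strip, mul_assoc, ← map_mul, ← mon_append]
      rfl) m
  simpa [strip_nil] using this

lemma ncDeriv_eq_left (p : NCPoly g) (m : ℕ) :
    ncDeriv p = ∑ w : Words g m, ∑ j,
        inclX g (mon (letters w).reverse) * hVar j * inclX g (strip (j :: letters w).reverse [] p) +
      ∑ w : Fin m → Fin g, inclX g (mon (List.ofFn w).reverse) *
        ncDeriv (strip (List.ofFn w).reverse [] p) := by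
  have := unfold_words (fun w => inclX g (mon w.reverse) * ncDeriv (strip w.reverse [] p))
    (fun w => ∑ j, inclX g (mon w.reverse) * hVar j * inclX g (strip (j :: w).reverse [] p))
    (fun w => by
      rw [ncDeriv_leftStrip]
      simp only [mul_add, Finset.mul_sum, strip_strip, ← mul_assoc, ← map_mul, ← mon_append,
        List.reverse_cons, List.append_nil]) m
  simpa [strip_nil] using this

lemma ncHessian_eq_right (p : NCPoly g) (m : ℕ) :
    ncHessian p = ∑ w : Words g m, ∑ j,
        (2 : ℝ) • (ncDeriv (strip [] (j :: letters w) p) * hVar j * inclX g (mon (letters w))) +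
      ∑ w : Fin m → Fin g, ncHessian (strip [] (List.ofFn w) p) * inclX g (mon (List.ofFn w)) := by
  have := unfold_words (fun w => ncHessian (strip [] w p) * inclX g (mon w))
    (fun w => ∑ j, (2 : ℝ) • (ncDeriv (strip [] (j :: w) p) * hVar j * inclX g (mon w)))
    (fun w => by
      rw [ncHessian_rightStrip]
      simp only [add_mul, Finset.sum_mul, strip_strip, mul_assoc, ← map_mul, ← mon_append,
        smul_mul_assoc]
      rfl) m
  simpa [strip_nil] using this

/-- A polynomial of degree at most one has derivative `∑ c_j h_j`. -/
lemma ncDeriv_of_linear {q : NCPoly g} (h : ∀ w : List (Fin g), 1 < w.length → coef w q = 0) :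
    ncDeriv q = ∑ j, coef [j] q • hVar j := by
  have hc : ∀ j, strip [] [j] q = algebraMap ℝ _ (coef [j] q) := fun j => by
    rw [eq_algebraMap_of_coef (p := strip [] [j] q), coef_strip]
    · simp
    · intro w hw
      rw [coef_strip]
      exact h _ (by have := List.length_pos_iff.2 hw; simp; omega)
  rw [ncDeriv_rightStrip]
  simp [hc, ncDeriv_algebraMap, Algebra.smul_def]

lemma ncHessian_of_linear {q : NCPoly g} (h : ∀ w : List (Fin g), 1 < w.length → coef w q = 0) :
    ncHessian q = 0 := by
  rw [ncHessian, ncDeriv_of_linear h, dirDeriv_sum]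
  simp [Algebra.smul_def, dirDeriv_mul, dirDeriv_algebraMap, dirDeriv_inr]

/-- The middle matrix whose entries are read off from the coefficients of `p`. -/
def middleMatrix (d : ℕ) (p : NCPoly g) : Matrix (BorderIdx g d) (BorderIdx g d) (NCPoly g) :=
  fun I J => (2 : ℝ) • strip (I.1 :: letters I.2).reverse (J.1 :: letters J.2) p

lemma border_eq {d : ℕ} (I : BorderIdx g d) :
    border I = hVar I.1 * inclX g (mon (letters I.2)) := by
  rw [border, inclX_mon, mon, List.map_map]
  rfl

lemma inclX_star (q : NCPoly g) : inclX g (star q) = star (inclX g q) := by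
  refine FreeAlgebra.induction ℝ (Fin g)
    (motive := fun q => inclX g (star q) = star (inclX g q)) ?_ ?_ ?_ ?_ q
  · intro r; simp
  · intro j; simp [inclX_ι]
  · intro a b ha hb; simp [ha, hb]
  · intro a b ha hb; simp [ha, hb]

lemma star_border {d : ℕ} (I : BorderIdx g d) :
    star (border I) = inclX g (mon (letters I.2).reverse) * hVar I.1 := by
  rw [border_eq, star_mul, ← inclX_star, star_mon, FreeAlgebra.star_ι]

/-- The Hessian is `Vᵀ Z V` for the matrix `Z = middleMatrix d p`. -/
lemma ncHessian_eq_middleMatrix {d : ℕ} {p : NCPoly g} (hd : ncDegree p ≤ d) :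
    ncHessian p = ∑ I : BorderIdx g d, ∑ J : BorderIdx g d,
      star (border I) * inclX g (middleMatrix d p I J) * border J := by
  rw [ncHessian_eq_right p (d - 1),
    Finset.sum_eq_zero (s := (Finset.univ : Finset (Fin (d - 1) → Fin g))), add_zero,
    Finset.sum_comm (s := (Finset.univ : Finset (BorderIdx g d))), Fintype.sum_prod_type_right]
  · refine Finset.sum_congr rfl fun w _ => Finset.sum_congr rfl fun j _ => ?_
    rw [ncDeriv_eq_left _ (d - 1),
      Finset.sum_eq_zero (s := (Finset.univ : Finset (Fin (d - 1) → Fin g))), add_zero,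
      Fintype.sum_prod_type_right]
    · simp only [Finset.sum_mul, Finset.smul_sum]
      refine Finset.sum_congr rfl fun w' _ => Finset.sum_congr rfl fun i _ => ?_
      rw [star_border, border_eq, middleMatrix, strip_strip]
      simp [mul_assoc]
    · intro w' _
      rw [strip_strip, eq_algebraMap_of_coef (p := strip _ _ p), ncDeriv_algebraMap, mul_zero]
      intro u hu
      rw [coef_strip]
      refine coef_eq_zero_of_ncDegree_lt ?_
      have := List.length_pos_iff.2 hu
      simp
      omega
  · intro w _
    rw [ncHessian_of_linear, zero_mul]
    intro u hu
    rw [coef_strip]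
    refine coef_eq_zero_of_ncDegree_lt ?_
    simp
    omega

lemma star_middleMatrix {d : ℕ} {p : NCPoly g} (hp : star p = p) (I J : BorderIdx g d) :
    star (middleMatrix d p I J) = middleMatrix d p J I := by
  simp [middleMatrix, star_smul', star_strip, hp]

lemma map_inl_append_inr_cons_inj {α : Type*} {a a' : List α} {i i' : α} {r r' : List (α ⊕ α)} :
    a.map Sum.inl ++ Sum.inr i :: r = a'.map Sum.inl ++ Sum.inr i' :: r' ↔
      a = a' ∧ i = i' ∧ r = r' := by
  induction a generalizing a' with
  | nil => cases a' <;> simp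
  | cons b a ih => cases a' <;> simp [ih, and_assoc]

/-- The coefficient of `w'ᵀ h_i h_j w` in `V* z V`. -/
lemma coef_star_border_mul {d : ℕ} (I J I' J' : BorderIdx g d) (z : NCPoly g) :
    coef (((letters I.2).map Sum.inl).reverse ++ [Sum.inr I.1, Sum.inr J.1] ++
        (letters J.2).map Sum.inl)
      (star (border I') * inclX g z * border J') =
      if I' = I ∧ J' = J then coef [] z else 0 := by
  classical
  let F : NCPoly g →ₗ[ℝ] ℝ := coef (((letters I.2).map Sum.inl).reverse ++
    [Sum.inr I.1, Sum.inr J.1] ++ (letters J.2).map Sum.inl) ∘ₗ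
    LinearMap.mulRight ℝ (border J') ∘ₗ LinearMap.mulLeft ℝ (star (border I')) ∘ₗ
      (inclX g).toLinearMap
  have : F = if I' = I ∧ J' = J then coef [] else 0 := by
    refine linearMap_ext_mon fun m => ?_
    change coef _ (star (border I') * inclX g (mon m) * border J') = _
    have : star (border I') * inclX g (mon m) * border J' =
        mon ((letters I'.2).reverse.map Sum.inl ++ (Sum.inr I'.1 :: (m.map Sum.inl ++
          (Sum.inr J'.1 :: (letters J'.2).map Sum.inl)))) := by
      rw [star_border, border_eq]
      simp only [inclX_mon, mon_append, mon_cons, mul_assoc]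
    rw [this, coef_mon]
    have hw : ((letters I.2).map Sum.inl).reverse ++ [Sum.inr I.1, Sum.inr J.1] ++
          (letters J.2).map Sum.inl = ((letters I'.2).reverse.map Sum.inl ++
          (Sum.inr I'.1 :: (m.map Sum.inl ++
          (Sum.inr J'.1 :: (letters J'.2).map Sum.inl))) : List (Fin g ⊕ Fin g)) ↔
        (I' = I ∧ J' = J) ∧ m = [] := by
      have h0 := map_inl_append_inr_cons_inj (α := Fin g) (a := []) (a' := m) (i := J.1)
        (i' := J'.1) (r := (letters J.2).map Sum.inl) (r' := (letters J'.2).map Sum.inl)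
      simp only [List.map_nil, List.nil_append] at h0
      rw [← List.map_reverse, List.append_assoc, List.cons_append, List.cons_append,
        List.nil_append, map_inl_append_inr_cons_inj, h0,
        (List.map_injective_iff.2 Sum.inl_injective).eq_iff, List.reverse_inj,
        letters_injective.eq_iff, letters_injective.eq_iff, Prod.ext_iff, Prod.ext_iff]
      grind
    simp only [hw]
    by_cases h : I' = I ∧ J' = J
    · simp [h, coef_mon, eq_comm]
    · rw [if_neg h, if_neg (fun h' => h h'.1)]
      rfl
  have := congrArg (fun f => f z) this
  refine this.trans ?_
  split_ifs <;> rfl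

/-- `Z(0)` is determined by the Hessian. -/
lemma scalarPart_eq_of_hessian {d : ℕ} {p : NCPoly g} (hd : ncDegree p ≤ d)
    (Z : Matrix (BorderIdx g d) (BorderIdx g d) (NCPoly g))
    (hZ : ncHessian p = ∑ I, ∑ J, star (border I) * inclX g (Z I J) * border J) :
    scalarPart Z = scalarPart (middleMatrix d p) := by
  have key : ∀ Z' : Matrix (BorderIdx g d) (BorderIdx g d) (NCPoly g), ∀ I J,
      coef (((letters I.2).map Sum.inl).reverse ++ [Sum.inr I.1, Sum.inr J.1] ++
        (letters J.2).map Sum.inl) (∑ I', ∑ J', star (border I') * inclX g (Z' I' J') * border J') =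
      coef [] (Z' I J) := fun Z' I J => by
    simp only [map_sum, coef_star_border_mul]
    rw [Finset.sum_eq_single I, Finset.sum_eq_single J] <;> simp +contextual
  ext I J
  simp only [scalarPart, Matrix.map_apply, coef_lift_zero]
  rw [← key, ← hZ, ncHessian_eq_middleMatrix hd, key]

lemma scalarPart_middleMatrix {d : ℕ} (p : NCPoly g) (I J : BorderIdx g d) :
    scalarPart (middleMatrix d p) I J =
      2 * coef ((I.1 :: letters I.2).reverse ++ (J.1 :: letters J.2)) p := by
  simp [scalarPart, coef_lift_zero, middleMatrix, coef_strip]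

end Derivatives

/-! ### Congruence of the middle matrix to a constant diagonal matrix -/

section Congruence

variable {g : ℕ}

open Polynomial in
/-- Truncations of the power series of `√(1 - T)`. -/
lemma exists_sqrt_one_sub_X (k : ℕ) :
    ∃ f r : ℝ[X], f ^ 2 = 1 - X + X ^ (k + 1) * r ∧ f.coeff 0 = 1 := by
  induction k with
  | zero => exact ⟨1, 1, by ring, by simp⟩
  | succ k ih =>
    obtain ⟨f, r, hf, hf0⟩ := ih
    have hr := r.divX_mul_X_add
    have hf1 := f.divX_mul_X_add
    set r0 := r.coeff 0
    rw [hf0, C_1] at hf1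
    refine ⟨f - C (r0 / 2) * X ^ (k + 1), r.divX - C r0 * f.divX + C (r0 / 2) ^ 2 * X ^ k, ?_, ?_⟩
    · have hC : C r0 = 2 * C (r0 / 2) := by
        rw [← C_ofNat, ← C_mul]
        congr 1
        ring
      rw [sub_sq, hf, hC]
      rw [hC] at hr
      linear_combination (-X ^ (k + 1)) * hr + (2 * C (r0 / 2) * X ^ (k + 1)) * hf1
    · simp [hf0]

/-- If `Z` and `(1 - N) Z` are self-adjoint with `N` nilpotent, then they are congruent: as
`N Z = Z N*`, one has `C Z C* = C² Z = (1 - N) Z` for the square root `C` of `1 - N`. -/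
lemma exists_congruence {A : Type*} [Ring A] [Algebra ℝ A] [StarRing A]
    (hsm : ∀ (c : ℝ) (a : A), star (c • a) = c • star a) {N Z Z₀ : A} (hN : IsNilpotent N)
    (hZ : star Z = Z) (hZ₀ : star Z₀ = Z₀) (h : (1 - N) * Z = Z₀) :
    ∃ Q Q' : A, Q * Q' = 1 ∧ Z = star Q * Z₀ * Q := by
  obtain ⟨k, hk⟩ := hN
  obtain ⟨f, r, hf, -⟩ := exists_sqrt_one_sub_X k
  set C := Polynomial.aeval N f with hC
  have hC2 : C ^ 2 = 1 - N := by
    rw [hC, ← map_pow, hf]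
    simp [pow_succ, hk]
  have hU : IsUnit C := by
    refine (isUnit_pow_iff two_ne_zero).1 ?_
    rw [hC2]
    exact IsNilpotent.isUnit_one_sub ⟨k, hk⟩
  have hNZ : N * Z = Z * star N := by
    have h2 : Z * (1 - star N) = Z₀ := by
      rw [← hZ₀, ← h, star_mul, hZ, star_sub, star_one]
    rw [← h, sub_mul, mul_sub, one_mul, mul_one, sub_right_inj] at h2
    exact h2.symm
  have hpow : ∀ m : ℕ, N ^ m * Z = Z * star (N ^ m) := fun m => by
    induction m with
    | zero => simp
    | succ m ih =>
      rw [pow_succ, mul_assoc, hNZ, ← mul_assoc, ih, star_mul, star_pow, mul_assoc, ← pow_succ,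
        ← pow_succ']
  have hCZ : C * Z = Z * star C := by
    rw [hC, Polynomial.aeval_eq_sum_range, Finset.sum_mul, star_sum, Finset.mul_sum]
    refine Finset.sum_congr rfl fun m _ => ?_
    rw [hsm, smul_mul_assoc, mul_smul_comm, hpow]
  obtain ⟨u, hu⟩ := hU
  refine ⟨star (↑u⁻¹ : A), star (u : A), ?_, ?_⟩
  · rw [← star_mul, u.mul_inv, star_one]
  · have hcz : C * Z * star C = Z₀ := by
      rw [hCZ, mul_assoc, ← star_mul, ← h, ← pow_two, hC2, sub_mul, hNZ, star_sub, star_one,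
        mul_sub, one_mul, mul_one]
    have h3 : star C * star (↑u⁻¹ : A) = 1 := by
      rw [← star_mul, ← hu, u.inv_mul, star_one]
    have h4 : (↑u⁻¹ : A) * C = 1 := by rw [← hu, u.inv_mul]
    rw [star_star, ← hcz]
    calc Z = ((↑u⁻¹ : A) * C) * Z * (star C * star (↑u⁻¹ : A)) := by rw [h3, h4]; simp
      _ = _ := by simp only [mul_assoc]

/-- The nilpotent matrix that links the rows of the middle matrix: stripping one more letter `x_k`
on the left of the entries in row `h_i w` yields row `h_k x_i w`. -/
def shiftMatrix (g d : ℕ) : Matrix (BorderIdx g d) (BorderIdx g d) (NCPoly g) :=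
  fun I K => if letters K.2 = I.1 :: letters I.2 then FreeAlgebra.ι ℝ K.1 else 0

lemma isNilpotent_shiftMatrix (g d : ℕ) : IsNilpotent (shiftMatrix g d) := by
  refine ⟨d, ?_⟩
  have key : ∀ (r : ℕ) (I K : BorderIdx g d), (shiftMatrix g d ^ r) I K ≠ 0 →
      (letters K.2).length = (letters I.2).length + r := by
    intro r
    induction r with
    | zero =>
      intro I K h
      have : I = K := by
        by_contra hne
        simp [hne] at h
      simp [this]
    | succ r ih =>
      intro I K h
      rw [pow_succ, Matrix.mul_apply] at h
      obtain ⟨L, -, hL⟩ := Finset.exists_ne_zero_of_sum_ne_zero h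
      have h1 := ih I L (left_ne_zero_of_mul hL)
      have h2 : letters K.2 = L.1 :: letters L.2 := by
        by_contra hne
        exact right_ne_zero_of_mul hL (if_neg hne)
      rw [h2, List.length_cons, h1]
      ring
  ext I K : 1
  by_contra h
  have h1 := key d I K h
  have h2 := length_letters_lt K.2
  omega

lemma sub_shiftMatrix_mul_middleMatrix {d : ℕ} {p : NCPoly g} (hd : ncDegree p ≤ d) :
    (1 - shiftMatrix g d) * middleMatrix d p =
      (scalarPart (middleMatrix d p)).map (algebraMap ℝ (NCPoly g)) := by
  ext I J : 1
  have hrow : (shiftMatrix g d * middleMatrix d p) I J =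
      ∑ k, FreeAlgebra.ι ℝ k * strip [k] [] (middleMatrix d p I J) := by
    rw [Matrix.mul_apply, Fintype.sum_prod_type]
    refine Finset.sum_congr rfl fun k _ => ?_
    have hstrip : strip [k] [] (middleMatrix d p I J) = (2 : ℝ) •
        strip (k :: I.1 :: letters I.2).reverse (J.1 :: letters J.2) p := by
      rw [middleMatrix, map_smul, strip_strip]
      simp
    rw [hstrip]
    by_cases hl : (I.1 :: letters I.2).length < d - 1
    · obtain ⟨w, hw⟩ := exists_letters hl
      rw [Finset.sum_eq_single w]
      · simp only [shiftMatrix, hw, if_true, middleMatrix]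
      · intro w' _ hne
        rw [shiftMatrix, if_neg, zero_mul]
        intro h
        exact hne (letters_injective (h.trans hw.symm))
      · simp
    · rw [Finset.sum_eq_zero]
      · rw [ext_coef (p := strip _ _ p) (q := 0), smul_zero, mul_zero]
        intro m
        rw [coef_strip, map_zero]
        refine coef_eq_zero_of_ncDegree_lt ?_
        simp only [List.length_append, List.length_reverse, List.length_cons] at hl ⊢
        omega
      · intro w _
        rw [shiftMatrix, if_neg, zero_mul]
        intro h
        exact hl (h ▸ length_letters_lt w)
  rw [sub_mul, one_mul, Matrix.sub_apply, hrow, scalarPart, Matrix.map_apply, Matrix.map_apply,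
    coef_lift_zero, sub_eq_iff_eq_add]
  exact eq_add_sum_ι_mul _

lemma isSymm_scalarPart_middleMatrix {d : ℕ} {p : NCPoly g} (hp : star p = p) :
    (scalarPart (middleMatrix d p)).IsSymm := by
  ext I J
  simp only [scalarPart, Matrix.transpose_apply, Matrix.map_apply, coef_lift_zero]
  rw [← star_middleMatrix hp J I, coef_star, List.reverse_nil]

/-- Orthogonal diagonalization of a real symmetric matrix, with `muPos` and `muNeg` as the
numbers of positive and negative diagonal entries. -/
lemma exists_diagonalization {m : Type} [Fintype m] [DecidableEq m] {A : Matrix m m ℝ}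
    (hA : A.IsSymm) : ∃ (O : Matrix m m ℝ) (l : m → ℝ), O * Oᵀ = 1 ∧
      A = Oᵀ * Matrix.diagonal l * O ∧
      muPos A = Fintype.card {k // 0 < l k} ∧ muNeg A = Fintype.card {k // l k < 0} := by
  have hH : A.IsHermitian := by
    rw [Matrix.IsHermitian, Matrix.conjTranspose_eq_transpose_of_trivial]
    exact hA
  refine ⟨(hH.eigenvectorUnitary : Matrix m m ℝ)ᵀ, hH.eigenvalues, ?_, ?_, ?_, ?_⟩
  · have := Unitary.coe_star_mul_self hH.eigenvectorUnitary
    rwa [Matrix.star_eq_conjTranspose, Matrix.conjTranspose_eq_transpose_of_trivial] at this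
  · have := hH.spectral_theorem
    rw [Unitary.conjStarAlgAut_apply, Matrix.star_eq_conjTranspose,
      Matrix.conjTranspose_eq_transpose_of_trivial] at this
    exact this
  · rw [muPos, hH.roots_charpoly_eq_eigenvalues, Multiset.filter_map, Multiset.card_map,
      Fintype.card_subtype]
    rfl
  · rw [muNeg, hH.roots_charpoly_eq_eigenvalues, Multiset.filter_map, Multiset.card_map,
      Fintype.card_subtype]
    rfl

/-- The middle matrix is congruent over `ℝ⟨x⟩` to a constant diagonal matrix, whose numbers of
positive and negative entries are the signature of `Z(0)`. -/
lemma exists_middleMatrix_eq_sum_squares {d : ℕ} {p : NCPoly g} (hp : star p = p)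
    (hd : ncDegree p ≤ d) :
    ∃ (Q Q' : Matrix (BorderIdx g d) (BorderIdx g d) (NCPoly g)) (l : BorderIdx g d → ℝ),
      Q * Q' = 1 ∧
      (∀ I J, middleMatrix d p I J = ∑ k, star (Q k I) * l k • Q k J) ∧
      muPos (scalarPart (middleMatrix d p)) = Fintype.card {k // 0 < l k} ∧
      muNeg (scalarPart (middleMatrix d p)) = Fintype.card {k // l k < 0} := by
  have hsymm := isSymm_scalarPart_middleMatrix (d := d) hp
  obtain ⟨O, l, hO, hdiag, hpos, hneg⟩ := exists_diagonalization hsymm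
  let φ : Matrix (BorderIdx g d) (BorderIdx g d) ℝ →+*
      Matrix (BorderIdx g d) (BorderIdx g d) (NCPoly g) := (algebraMap ℝ (NCPoly g)).mapMatrix
  have hφ : ∀ M, star (φ M) = φ Mᵀ := fun M => by
    ext I J : 1
    simp [φ]
  obtain ⟨Q, Q', hQ, hZ⟩ := exists_congruence
    (A := Matrix (BorderIdx g d) (BorderIdx g d) (NCPoly g))
    (fun c a => by
      ext I J : 1
      simp [Matrix.star_eq_conjTranspose, star_smul']) (isNilpotent_shiftMatrix g d)
    (Z := middleMatrix d p) (Z₀ := φ (scalarPart (middleMatrix d p)))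
    (by
      ext I J : 1
      simp [star_middleMatrix hp]) (by rw [hφ, hsymm.eq])
    (sub_shiftMatrix_mul_middleMatrix hd)
  refine ⟨φ O * Q, Q' * φ Oᵀ, l, ?_, fun I J => ?_, hpos, hneg⟩
  · rw [mul_assoc, ← mul_assoc Q, hQ, one_mul, ← map_mul, hO, map_one]
  · have : middleMatrix d p = star (φ O * Q) * (φ (Matrix.diagonal l) * (φ O * Q)) := by
      conv_lhs => rw [hZ, hdiag]
      rw [star_mul, hφ, map_mul, map_mul]
      simp only [mul_assoc]
    conv_lhs => rw [this]
    rw [Matrix.mul_apply]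
    refine Finset.sum_congr rfl fun k _ => ?_
    have hd' : φ (Matrix.diagonal l) = Matrix.diagonal fun k => algebraMap ℝ (NCPoly g) (l k) := by
      simp [φ, Matrix.diagonal_map]
    rw [hd', Matrix.diagonal_mul, Algebra.smul_def]
    rfl

end Congruence

/-! ### Evaluation, sums of squares and the upper bound -/

section UpperBound

variable {g n : ℕ}

lemma evalX_mul (p q : NCPoly g) (X : MatTuple g n) : evalX (p * q) X = evalX p X * evalX q X :=
  map_mul _ _ _

lemma evalX_neg (p : NCPoly g) (X : MatTuple g n) : evalX (-p) X = -evalX p X :=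
  map_neg _ _

lemma evalX_sum {ι : Type*} (s : Finset ι) (f : ι → NCPoly g) (X : MatTuple g n) :
    evalX (∑ i ∈ s, f i) X = ∑ i ∈ s, evalX (f i) X :=
  map_sum _ _ _

lemma evalX_smul (c : ℝ) (p : NCPoly g) (X : MatTuple g n) : evalX (c • p) X = c • evalX p X :=
  map_smul _ _ _

lemma evalX_one (X : MatTuple g n) : evalX (1 : NCPoly g) X = 1 := map_one _

lemma evalX_zero (X : MatTuple g n) : evalX (0 : NCPoly g) X = 0 := map_zero _

lemma evalXH_mul (p q : NCPolyXH g) (X H : MatTuple g n) :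
    evalXH (p * q) X H = evalXH p X H * evalXH q X H :=
  map_mul _ _ _

lemma evalXH_add (p q : NCPolyXH g) (X H : MatTuple g n) :
    evalXH (p + q) X H = evalXH p X H + evalXH q X H :=
  map_add _ _ _

lemma evalXH_neg (p : NCPolyXH g) (X H : MatTuple g n) : evalXH (-p) X H = -evalXH p X H :=
  map_neg _ _

lemma evalXH_sum {ι : Type*} (s : Finset ι) (f : ι → NCPolyXH g) (X H : MatTuple g n) :
    evalXH (∑ i ∈ s, f i) X H = ∑ i ∈ s, evalXH (f i) X H :=
  map_sum _ _ _

lemma evalXH_smul (c : ℝ) (p : NCPolyXH g) (X H : MatTuple g n) :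
    evalXH (c • p) X H = c • evalXH p X H :=
  map_smul _ _ _

lemma evalXH_inr (j : Fin g) (X H : MatTuple g n) : evalXH (hVar j) X H = H j := by
  simp [evalXH]

lemma evalXH_inclX (q : NCPoly g) (X H : MatTuple g n) : evalXH (inclX g q) X H = evalX q X := by
  have : (FreeAlgebra.lift ℝ (Sum.elim X H)).comp (inclX g) = FreeAlgebra.lift ℝ X := by
    refine FreeAlgebra.hom_ext (funext fun j => ?_)
    simp [inclX_ι]
  exact congrArg (fun f => f q) this

lemma evalXH_star (f : NCPolyXH g) {X H : MatTuple g n} (hX : IsSymmTuple X)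
    (hH : IsSymmTuple H) : evalXH (star f) X H = (evalXH f X H)ᵀ := by
  refine FreeAlgebra.induction ℝ (Fin g ⊕ Fin g)
    (motive := fun f => evalXH (star f) X H = (evalXH f X H)ᵀ) ?_ ?_ ?_ ?_ f
  · intro r
    simp [evalXH, Matrix.algebraMap_eq_diagonal]
  · rintro (j | j)
    · simp [evalXH, (hX j).eq]
    · simp [evalXH, (hH j).eq]
  · intro a b ha hb
    rw [star_mul, evalXH_mul, evalXH_mul, ha, hb, Matrix.transpose_mul]
  · intro a b ha hb
    rw [star_add, evalXH_add, evalXH_add, ha, hb, Matrix.transpose_add]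

lemma evalX_star (p : NCPoly g) {X : MatTuple g n} (hX : IsSymmTuple X) :
    evalX (star p) X = (evalX p X)ᵀ := by
  rw [← evalXH_inclX _ X X, inclX_star, evalXH_star _ hX hX, evalXH_inclX]

lemma evalXH_border {d : ℕ} (I : BorderIdx g d) (X H : MatTuple g n) :
    evalXH (border I) X H = H I.1 * evalX (mon (letters I.2)) X := by
  rw [border_eq, evalXH_mul, evalXH_inr, evalXH_inclX]

/-- The entries of `Q V` for the border vector `V`, as polynomials. -/
def sqPoly {d : ℕ} (Q : Matrix (BorderIdx g d) (BorderIdx g d) (NCPoly g)) (k : BorderIdx g d) :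
    NCPolyXH g :=
  ∑ J, inclX g (Q k J) * border J

/-- The Hessian of `p` is the weighted sum of squares `(QV)* diag(l) (QV)`. -/
def IsHessianSquares {d : ℕ} (p : NCPoly g)
    (Q : Matrix (BorderIdx g d) (BorderIdx g d) (NCPoly g)) (l : BorderIdx g d → ℝ) : Prop :=
  ncHessian p = ∑ k, l k • (star (sqPoly Q k) * sqPoly Q k)

lemma IsHessianSquares.neg {d : ℕ} {p : NCPoly g}
    {Q : Matrix (BorderIdx g d) (BorderIdx g d) (NCPoly g)} {l : BorderIdx g d → ℝ}
    (h : IsHessianSquares p Q l) : IsHessianSquares (-p) Q (-l) := by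
  rw [IsHessianSquares, ncHessian_neg, h]
  simp

lemma isHessianSquares_of_middleMatrix {d : ℕ} {p : NCPoly g} (hd : ncDegree p ≤ d)
    {Q : Matrix (BorderIdx g d) (BorderIdx g d) (NCPoly g)} {l : BorderIdx g d → ℝ}
    (h : ∀ I J, middleMatrix d p I J = ∑ k, star (Q k I) * l k • Q k J) :
    IsHessianSquares p Q l := by
  rw [IsHessianSquares, ncHessian_eq_middleMatrix hd]
  simp only [h, sqPoly, star_sum, Finset.sum_mul, Finset.mul_sum, map_sum, Finset.smul_sum,
    star_mul, map_mul, inclX_star, map_smul]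
  rw [Finset.sum_congr rfl fun I _ => Finset.sum_comm, Finset.sum_comm]
  refine Finset.sum_congr rfl fun k _ => ?_
  rw [Finset.sum_comm]
  refine Finset.sum_congr rfl fun J _ => Finset.sum_congr rfl fun I _ => ?_
  simp only [mul_assoc, mul_smul_comm, smul_mul_assoc]

/-- The vector `(QV)_k(X)[H] v`. -/
def sqVec {d : ℕ} (Q : Matrix (BorderIdx g d) (BorderIdx g d) (NCPoly g)) (X : MatTuple g n)
    (v : Fin n → ℝ) (k : BorderIdx g d) (H : MatTuple g n) : Fin n → ℝ :=
  evalXH (sqPoly Q k) X H *ᵥ v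

lemma sqVec_eq {d : ℕ} (Q : Matrix (BorderIdx g d) (BorderIdx g d) (NCPoly g))
    (X : MatTuple g n) (v : Fin n → ℝ) (k : BorderIdx g d) (H : MatTuple g n) :
    sqVec Q X v k H =
      ∑ J, evalX (Q k J) X *ᵥ (H J.1 *ᵥ (evalX (mon (letters J.2)) X *ᵥ v)) := by
  simp only [sqVec, sqPoly, evalXH_sum, evalXH_mul, evalXH_inclX, evalXH_border,
    Matrix.sum_mulVec, Matrix.mulVec_mulVec]

/-- `sqVec` as a linear map of the direction. -/
def sqLin {d : ℕ} (Q : Matrix (BorderIdx g d) (BorderIdx g d) (NCPoly g)) (X : MatTuple g n)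
    (v : Fin n → ℝ) (k : BorderIdx g d) : MatTuple g n →ₗ[ℝ] (Fin n → ℝ) where
  toFun := sqVec Q X v k
  map_add' H H' := by
    simp only [sqVec_eq, Pi.add_apply, Matrix.add_mulVec, Matrix.mulVec_add,
      Finset.sum_add_distrib]
  map_smul' c H := by
    simp only [sqVec_eq, Pi.smul_apply, Matrix.smul_mulVec, Matrix.mulVec_smul, Finset.smul_sum,
      RingHom.id_apply]

lemma quadForm_hessian {d : ℕ} {p : NCPoly g}
    {Q : Matrix (BorderIdx g d) (BorderIdx g d) (NCPoly g)} {l : BorderIdx g d → ℝ}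
    (h : IsHessianSquares p Q l) {X H : MatTuple g n} (hX : IsSymmTuple X) (hH : IsSymmTuple H)
    (v : Fin n → ℝ) :
    quadForm (ncHessian p) X v H = ∑ k, l k * (sqVec Q X v k H ⬝ᵥ sqVec Q X v k H) := by
  rw [quadForm, h]
  simp only [evalXH_sum, evalXH_smul, evalXH_mul, evalXH_star _ hX hH, Matrix.sum_mulVec,
    Matrix.smul_mulVec, sum_dotProduct, smul_dotProduct, smul_eq_mul, sqVec]
  refine Finset.sum_congr rfl fun k _ => ?_
  rw [← Matrix.mulVec_mulVec, Matrix.mulVec_transpose, ← Matrix.dotProduct_mulVec]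

/-- A subspace on which a weighted sum of squares of vectors in `ℝⁿ` is positive has dimension
at most `n` times the number of positive weights: the squares with positive weights are
jointly injective on it. -/
lemma finrank_le_of_sum_squares_pos {ι E : Type*} [Fintype ι] [AddCommGroup E] [Module ℝ E]
    (l : ι → ℝ) (y : ι → E →ₗ[ℝ] (Fin n → ℝ))
    (h : ∀ x : E, x ≠ 0 → 0 < ∑ k, l k * (y k x ⬝ᵥ y k x)) :
    Module.finrank ℝ E ≤ n * Fintype.card {k // 0 < l k} := by
  let f : E →ₗ[ℝ] ({k // 0 < l k} → Fin n → ℝ) := LinearMap.pi fun k => y k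
  have hf : Function.Injective f := by
    rw [← LinearMap.ker_eq_bot, LinearMap.ker_eq_bot']
    intro x hx
    by_contra hne
    refine (h x hne).not_ge (Finset.sum_nonpos fun k _ => ?_)
    by_cases hk : 0 < l k
    · have : y k x = 0 := congrFun hx ⟨k, hk⟩
      simp [this]
    · exact mul_nonpos_of_nonpos_of_nonneg (not_lt.1 hk)
        (Finset.sum_nonneg fun i _ => mul_self_nonneg _)
  have := LinearMap.finrank_le_finrank_of_injective hf
  simpa [Module.finrank_pi_fintype, mul_comm] using this

lemma bddAbove_finrank {E : Type*} [AddCommGroup E] [Module ℝ E] [FiniteDimensional ℝ E]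
    (P : Submodule ℝ E → Prop) :
    BddAbove {k | ∃ W : Submodule ℝ E, P W ∧ Module.finrank ℝ W = k} :=
  ⟨Module.finrank ℝ E, by rintro _ ⟨W, -, rfl⟩; exact Submodule.finrank_le W⟩

lemma ePos_def {X : MatTuple g n} {v : Fin n → ℝ} {f : NCPolyXH g} {𝓗 : Set (MatTuple g n)} :
    ePos X v f 𝓗 = sSup {k | ∃ W : Submodule ℝ (MatTuple g n), ((W : Set (MatTuple g n)) ⊆ 𝓗 ∧
      (∀ H ∈ W, H ≠ 0 → 0 < quadForm f X v H)) ∧ Module.finrank ℝ W = k} := by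
  simp only [ePos, and_assoc]

lemma zero_mem_clampedTangent (p : NCPoly g) (X : MatTuple g n) (v : Fin n → ℝ) :
    (0 : MatTuple g n) ∈ clampedTangent p X v := by
  refine ⟨fun j => Matrix.isSymm_zero, ?_⟩
  rw [ncDeriv_eq_right p (ncDegree p), evalXH_add, evalXH_sum, evalXH_sum,
    Finset.sum_eq_zero, Finset.sum_eq_zero]
  · simp
  · intro w _
    rw [eq_algebraMap_of_coef (p := strip _ _ p), ncDeriv_algebraMap]
    · simp [evalXH]
    · intro u hu
      rw [coef_strip]
      refine coef_eq_zero_of_ncDegree_lt ?_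
      have := List.length_pos_iff.2 hu
      simpa
  · intro w _
    simp [evalXH_sum, evalXH_mul, evalXH_inr]

/-- The supremum that defines `cPos` is attained. -/
lemma exists_finrank_eq_cPos (p : NCPoly g) (X : MatTuple g n) (v : Fin n → ℝ) :
    ∃ W : Submodule ℝ (MatTuple g n), ((W : Set (MatTuple g n)) ⊆ clampedTangent p X v ∧
      (∀ H ∈ W, H ≠ 0 → 0 < quadForm (ncHessian p) X v H)) ∧
      Module.finrank ℝ W = cPos p X v := by
  rw [cPos, ePos_def]
  refine Nat.sSup_mem (s := {k | ∃ W : Submodule ℝ (MatTuple g n),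
    ((W : Set (MatTuple g n)) ⊆ clampedTangent p X v ∧
      (∀ H ∈ W, H ≠ 0 → 0 < quadForm (ncHessian p) X v H)) ∧ Module.finrank ℝ W = k}) ?_
    (bddAbove_finrank _)
  refine ⟨0, ⊥, ⟨?_, ?_⟩, by simp⟩
  · rintro _ rfl
    exact zero_mem_clampedTangent p X v
  · intro H hH hne
    exact absurd ((Submodule.mem_bot ℝ).1 hH) hne

lemma finrank_le_cPos {p : NCPoly g} {X : MatTuple g n} {v : Fin n → ℝ} {E : Type*}
    [AddCommGroup E] [Module ℝ E] (f : E →ₗ[ℝ] MatTuple g n)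
    (hT : ∀ x, f x ∈ clampedTangent p X v) (h0 : ∀ x, f x = 0 → x = 0)
    (hq : ∀ x, x ≠ 0 → 0 < quadForm (ncHessian p) X v (f x)) :
    Module.finrank ℝ E ≤ cPos p X v := by
  have hinj : Function.Injective f := by
    rw [← LinearMap.ker_eq_bot, LinearMap.ker_eq_bot']
    exact h0
  rw [← LinearMap.finrank_range_of_inj hinj, cPos, ePos_def]
  refine le_csSup (bddAbove_finrank _) ⟨LinearMap.range f, ⟨?_, ?_⟩, rfl⟩
  · rintro _ ⟨x, rfl⟩
    exact hT x
  · rintro _ ⟨x, rfl⟩ hx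
    exact hq x fun h => hx (by rw [h, map_zero])

lemma cNeg_eq_cPos_neg (p : NCPoly g) (X : MatTuple g n) (v : Fin n → ℝ) :
    cNeg p X v = cPos (-p) X v := by
  have h1 : clampedTangent (-p) X v = clampedTangent p X v := by
    ext H
    simp [clampedTangent, ncDeriv_neg, evalXH_neg, Matrix.neg_mulVec]
  have h2 : ∀ H, quadForm (ncHessian (-p)) X v H = -quadForm (ncHessian p) X v H := fun H => by
    simp [quadForm, ncHessian_neg, evalXH_neg, Matrix.neg_mulVec]
  simp only [cNeg, cPos, eNeg, ePos, h1, h2, neg_pos]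

/-- The upper bound `c₊ⁿ(X, v; p) ≤ n μ₊(Z(0))`. -/
lemma cPos_le {d : ℕ} {p : NCPoly g}
    {Q : Matrix (BorderIdx g d) (BorderIdx g d) (NCPoly g)} {l : BorderIdx g d → ℝ}
    (h : IsHessianSquares p Q l) {X : MatTuple g n} (hX : IsSymmTuple X) (v : Fin n → ℝ) :
    cPos p X v ≤ n * Fintype.card {k // 0 < l k} := by
  obtain ⟨W, ⟨hT, hW⟩, hdim⟩ := exists_finrank_eq_cPos p X v
  rw [← hdim]
  refine finrank_le_of_sum_squares_pos l (fun k => sqLin Q X v k ∘ₗ W.subtype) fun x hx => ?_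
  have := hW x x.2 (by simpa using hx)
  rwa [quadForm_hessian h hX (hT x.2).1] at this

end UpperBound

/-! ### The lower bound at points with independent words -/

section LowerBound

variable {g n : ℕ}

/-- The matrix whose columns are the vectors `w(X) v`, `w` a word of length less than `d`. -/
def wordMatrix (d : ℕ) (X : MatTuple g n) (v : Fin n → ℝ) : Matrix (Fin n) (Words g d) ℝ :=
  fun i w => (evalX (mon (letters w)) X *ᵥ v) i

/-- The vectors `w(X) v`, `w` a word of length less than `d`, are linearly independent. -/
def IndepWords (d : ℕ) (X : MatTuple g n) (v : Fin n → ℝ) : Prop :=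
  ∀ c, wordMatrix d X v *ᵥ c = 0 → c = 0

/-- If `U` has full column rank, `H U = Yᵀ` has a symmetric solution `H`, linear in `Y`, as soon
as `Y U` is symmetric: with `M U = 1` one takes `H = Yᵀ M + Mᵀ Y - Mᵀ (Y U)ᵀ M`. -/
lemma exists_symm_solution {W : Type*} [Fintype W] [DecidableEq W] {U : Matrix (Fin n) W ℝ}
    (hU : ∀ c, U *ᵥ c = 0 → c = 0) :
    ∃ Φ : Matrix W (Fin n) ℝ →ₗ[ℝ] Matrix (Fin n) (Fin n) ℝ,
      ∀ Y, (Y * U).IsSymm → (Φ Y).IsSymm ∧ Φ Y * U = Yᵀ := by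
  obtain ⟨f, hf⟩ := LinearMap.exists_leftInverse_of_injective (Matrix.toLin' U)
    (LinearMap.ker_eq_bot'.2 hU)
  have hM : LinearMap.toMatrix' f * U = 1 := by
    conv_lhs => rw [← LinearMap.toMatrix'_toLin' U]
    rw [← LinearMap.toMatrix'_comp, hf, LinearMap.toMatrix'_id]
  set M := LinearMap.toMatrix' f
  refine ⟨{ toFun := fun Y => Yᵀ * M + Mᵀ * Y - Mᵀ * (Y * U)ᵀ * M
            map_add' := fun Y Y' => by
              simp only [Matrix.add_mul, Matrix.mul_add, Matrix.transpose_add]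
              abel
            map_smul' := fun c Y => by
              simp [smul_sub, smul_add] }, fun Y hY => ⟨?_, ?_⟩⟩
  · simp only [LinearMap.coe_mk, AddHom.coe_mk, hY.eq]
    simp only [Matrix.IsSymm, Matrix.transpose_sub, Matrix.transpose_add, Matrix.transpose_mul,
      Matrix.transpose_transpose]
    rw [← Matrix.transpose_mul Y U, hY.eq, add_comm, Matrix.mul_assoc Mᵀ]
  · simp only [LinearMap.coe_mk, AddHom.coe_mk, hY.eq]
    simp only [Matrix.sub_mul, Matrix.add_mul, Matrix.mul_assoc, hM, Matrix.mul_one]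
    simp

/-- The lower bound for `c₊ⁿ(X, v; p)` at a point where the words of length less than `d` are
independent. Prescribing the vectors `H_j w(X) v` with `w` of length at most `d - 2` arbitrarily,
the equation `p'(X)[H] v = 0` is solved through the vector `H_j w(X) v` for a leading word `x_j w`
of `p`; only the symmetry of `H` imposes conditions, and their number does not depend on `n`. -/
lemma le_cPos_add {d : ℕ} {p : NCPoly g} (hd : ncDegree p ≤ d) {u : List (Fin g)}
    (hu : u.length = d) (hu0 : coef u p ≠ 0) (hd1 : 1 ≤ d)
    {Q Q' : Matrix (BorderIdx g d) (BorderIdx g d) (NCPoly g)} {l : BorderIdx g d → ℝ}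
    (h : IsHessianSquares p Q l) (hQ : Q * Q' = 1) {X : MatTuple g n} (hX : IsSymmTuple X)
    {v : Fin n → ℝ} (hXv : IndepWords d X v) :
    n * Fintype.card {k // 0 < l k} ≤ cPos p X v + g * Fintype.card (Words g d) ^ 2 := by
  set D := {k // 0 < l k} → Fin n → ℝ
  -- vectors `y` for the border vector that make `Q(X) y` vanish outside the positive weights
  let yL : D →ₗ[ℝ] (BorderIdx g d → Fin n → ℝ) := LinearMap.pi fun J => ∑ k,
    (evalX (Q' J k) X).mulVecLin ∘ₗ (if h : 0 < l k then LinearMap.proj (⟨k, h⟩ : {k // 0 < l k})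
      else 0)
  have hyL : ∀ z k, ∑ J, evalX (Q k J) X *ᵥ yL z J = if h : 0 < l k then z ⟨k, h⟩ else 0 := by
    intro z k
    have hone : ∀ k', ∑ J, evalX (Q k J) X * evalX (Q' J k') X = if k = k' then 1 else 0 := by
      intro k'
      have := congrArg (fun A => evalX (A k k') X) hQ
      simp only [Matrix.mul_apply, evalX_sum, evalX_mul, Matrix.one_apply] at this
      rw [this]
      split_ifs
      · exact evalX_one X
      · exact evalX_zero X
    simp only [yL, LinearMap.pi_apply, LinearMap.sum_apply, Matrix.mulVec_sum,
      LinearMap.comp_apply, Matrix.mulVecLin_apply, Matrix.mulVec_mulVec]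
    rw [Finset.sum_comm]
    simp only [← Matrix.sum_mulVec, hone]
    rw [Finset.sum_eq_single k]
    · rw [if_pos rfl, Matrix.one_mulVec]
      split_ifs <;> rfl
    · intro k' _ hne
      rw [if_neg hne.symm, Matrix.zero_mulVec]
    · simp
  -- the vector for the leading word `u` that makes `p'(X)[H] v` vanish
  let τ : (BorderIdx g d → Fin n → ℝ) →ₗ[ℝ] (Fin n → ℝ) := (-(coef u p)⁻¹) •
    ∑ w : Words g (d - 1), ∑ j, (evalX (strip [] (j :: letters w) p) X).mulVecLin ∘ₗ
      LinearMap.proj ((j, w) : BorderIdx g d)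
  let YL : (BorderIdx g d → Fin n → ℝ) →ₗ[ℝ] (Fin g → Matrix (Words g d) (Fin n) ℝ) :=
    LinearMap.pi fun j => (Matrix.ofLinearEquiv ℝ).toLinearMap ∘ₗ LinearMap.pi fun w =>
      if hw : (w.1 : ℕ) < d - 1 then LinearMap.proj ((j, ⟨⟨w.1, hw⟩, w.2⟩) : BorderIdx g d)
      else if j :: letters w = u then τ else 0
  have hYL : ∀ y j w, YL y j w = (if hw : (w.1 : ℕ) < d - 1
      then LinearMap.proj ((j, ⟨⟨w.1, hw⟩, w.2⟩) : BorderIdx g d)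
      else if j :: letters w = u then τ else 0 : (BorderIdx g d → Fin n → ℝ) →ₗ[ℝ] _) y :=
    fun _ _ _ => rfl
  obtain ⟨Φ, hΦ⟩ := exists_symm_solution hXv
  set U := wordMatrix d X v
  let S : (Fin g → Matrix (Words g d) (Fin n) ℝ) →ₗ[ℝ]
      (Fin g → Matrix (Words g d) (Words g d) ℝ) :=
    { toFun := fun Y j => Y j * U - (Y j * U)ᵀ
      map_add' := fun Y Y' => by
        ext j : 1
        simp only [Pi.add_apply, Matrix.add_mul, Matrix.transpose_add]
        abel
      map_smul' := fun c Y => by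
        ext j : 1
        simp [smul_sub] }
  let K := LinearMap.ker (S ∘ₗ YL ∘ₗ yL)
  let f : K →ₗ[ℝ] MatTuple g n :=
    (LinearMap.pi fun j => Φ ∘ₗ LinearMap.proj j) ∘ₗ YL ∘ₗ yL ∘ₗ K.subtype
  have hf : ∀ (z : K) (j : Fin g), (f z j).IsSymm ∧ ∀ w : Words g d,
      f z j *ᵥ (evalX (mon (letters w)) X *ᵥ v) = YL (yL z) j w := by
    intro z j
    have hz : S (YL (yL z)) j = 0 := congrFun (LinearMap.mem_ker.1 z.2) j
    obtain ⟨h1, h2⟩ := hΦ (YL (yL z) j) (sub_eq_zero.1 hz).symm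
    refine ⟨h1, fun w => ?_⟩
    ext i
    exact congrFun (congrFun h2 i) w
  have hf1 : ∀ (z : K) (J : BorderIdx g d),
      f z J.1 *ᵥ (evalX (mon (letters J.2)) X *ᵥ v) = yL z J := by
    intro z J
    have hlt : (J.2.1 : ℕ) < d := by omega
    refine ((hf z J.1).2 ⟨⟨J.2.1, hlt⟩, J.2.2⟩).trans ?_
    have hlt' : (J.2.1 : ℕ) < d - 1 := J.2.1.2
    rw [hYL, dif_pos hlt']
    rfl
  have hf2 : ∀ (z : K) (j : Fin g) (w : Fin (d - 1) → Fin g),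
      f z j *ᵥ (evalX (mon (List.ofFn w)) X *ᵥ v) =
        if j :: List.ofFn w = u then τ (yL z) else 0 := by
    intro z j w
    refine ((hf z j).2 ⟨⟨d - 1, by omega⟩, w⟩).trans ?_
    rw [hYL, dif_neg (by simp)]
    by_cases hju : j :: letters (⟨⟨d - 1, by omega⟩, w⟩ : Words g d) = u
    · rw [if_pos hju, if_pos (by exact hju)]
    · rw [if_neg hju, if_neg (by exact hju), LinearMap.zero_apply]
  have hsq : ∀ (z : K) k, sqVec Q X v k (f z) = if h : 0 < l k then (z : D) ⟨k, h⟩ else 0 := by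
    intro z k
    rw [sqVec_eq, ← hyL]
    exact Finset.sum_congr rfl fun J _ => by rw [hf1]
  have hsymm : ∀ z, IsSymmTuple (f z) := fun z j => (hf z j).1
  have hT : ∀ z, f z ∈ clampedTangent p X v := by
    refine fun z => ⟨hsymm z, ?_⟩
    have hlead : ∑ w : Fin (d - 1) → Fin g, ∑ j, coef (j :: List.ofFn w) p •
        (f z j *ᵥ (evalX (mon (List.ofFn w)) X *ᵥ v)) = coef u p • τ (yL z) := by
      simp only [hf2]
      cases u with
      | nil => simp at hu; omega
      | cons j₀ w₀ =>
        have hw₀ : w₀.length = d - 1 := by simp at hu; omega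
        obtain ⟨w₁, rfl⟩ : ∃ w₁ : Fin (d - 1) → Fin g, List.ofFn w₁ = w₀ := by
          subst hu
          exact ⟨w₀.get, List.ofFn_get w₀⟩
        rw [Finset.sum_eq_single w₁, Finset.sum_eq_single j₀]
        · simp
        · intro j _ hne
          simp [hne]
        · simp
        · intro w _ hne
          refine Finset.sum_eq_zero fun j _ => ?_
          rw [if_neg, smul_zero]
          intro he
          exact hne (List.ofFn_injective (List.cons.inj he).2)
        · simp
    have hlin : ∀ w : Fin (d - 1) → Fin g, ncDeriv (strip [] (List.ofFn w) p) =
        ∑ j, coef (j :: List.ofFn w) p • hVar j := fun w => by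
      rw [ncDeriv_of_linear]
      · simp [coef_strip]
      · intro m hm
        rw [coef_strip]
        refine coef_eq_zero_of_ncDegree_lt ?_
        simp
        omega
    rw [ncDeriv_eq_right p (d - 1)]
    simp only [hlin, evalXH_add, evalXH_sum, evalXH_mul, evalXH_inclX, evalXH_inr, evalXH_smul,
      Matrix.add_mulVec, Matrix.sum_mulVec, Finset.sum_mul, smul_mul_assoc, Matrix.smul_mulVec,
      ← Matrix.mulVec_mulVec]
    rw [hlead]
    simp only [τ, LinearMap.smul_apply, LinearMap.sum_apply, LinearMap.comp_apply,
      Matrix.mulVecLin_apply, LinearMap.proj_apply, smul_smul, mul_neg, mul_inv_cancel₀ hu0]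
    rw [neg_one_smul, add_neg_eq_zero]
    exact Finset.sum_congr rfl fun w _ => Finset.sum_congr rfl fun j _ => by
      rw [hf1 z (j, w)]
  have hK : Module.finrank ℝ K ≤ cPos p X v := by
    refine finrank_le_cPos f hT (fun z hz => ?_) (fun z hz => ?_)
    · ext k i
      have h1 := hsq z k
      rw [hz, dif_pos k.2] at h1
      have h2 : sqVec Q X v k 0 = 0 := (sqLin Q X v k).map_zero
      rw [h2] at h1
      exact (congrFun h1 i).symm
    · rw [quadForm_hessian h hX (hsymm z)]
      obtain ⟨k, hk⟩ : ∃ k, (z : D) k ≠ 0 := by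
        by_contra! hc
        exact hz (Subtype.ext (funext hc))
      refine Finset.sum_pos' (fun k' _ => ?_) ⟨k, Finset.mem_univ _, ?_⟩
      · rw [hsq]
        split_ifs with hk'
        · exact mul_nonneg hk'.le (Finset.sum_nonneg fun i _ => mul_self_nonneg _)
        · simp
      · rw [hsq, dif_pos k.2]
        exact mul_pos k.2 (lt_of_le_of_ne (Finset.sum_nonneg fun i _ => mul_self_nonneg _)
          (Ne.symm fun h0 => hk (dotProduct_self_eq_zero.1 h0)))
  have hrank := LinearMap.finrank_range_add_finrank_ker (S ∘ₗ YL ∘ₗ yL)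
  have hrange := Submodule.finrank_le (LinearMap.range (S ∘ₗ YL ∘ₗ yL))
  have hD : Module.finrank ℝ D = n * Fintype.card {k // 0 < l k} := by
    simp [D, Module.finrank_pi_fintype, mul_comm]
  have hE : Module.finrank ℝ (Fin g → Matrix (Words g d) (Words g d) ℝ) =
      g * Fintype.card (Words g d) ^ 2 := by
    rw [Module.finrank_pi_fintype]
    simp only [Module.finrank_matrix, Module.finrank_self, mul_one, Finset.sum_const,
      Finset.card_univ, Fintype.card_fin, smul_eq_mul, pow_two]
  rw [hD] at hrank
  rw [hE] at hrange
  have : Module.finrank ℝ K = Module.finrank ℝ (LinearMap.ker (S ∘ₗ YL ∘ₗ yL)) := rfl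
  omega

end LowerBound

/-! ### Direct sums and the asymptotic signature -/

section Sums

variable {g : ℕ}

section DirectSums
variable {t : ℕ} {n : Fin t → ℕ}

/-- `diag(A¹, …, Aᵗ)` as a homomorphism of algebras. -/
def diagHom (n : Fin t → ℕ) : (∀ i, Matrix (Fin (n i)) (Fin (n i)) ℝ) →ₐ[ℝ]
    Matrix (Fin (∑ i, n i)) (Fin (∑ i, n i)) ℝ :=
  (Matrix.reindexAlgEquiv ℝ ℝ finSigmaFinEquiv).toAlgHom.comp
    { Matrix.blockDiagonal'RingHom (fun i => Fin (n i)) ℝ with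
      commutes' := fun r => by
        have : (algebraMap ℝ (∀ i, Matrix (Fin (n i)) (Fin (n i)) ℝ)) r = r • 1 :=
          Algebra.algebraMap_eq_smul_one r
        simp [this, Matrix.blockDiagonal'_smul, Algebra.algebraMap_eq_smul_one] }

lemma diagSum_eq (X : ∀ i, MatTuple g (n i)) (j : Fin g) :
    diagSum X j = diagHom n fun i => X i j := rfl

lemma diagHom_mulVec (A : ∀ i, Matrix (Fin (n i)) (Fin (n i)) ℝ) (v : ∀ i, Fin (n i) → ℝ) :
    diagHom n A *ᵥ colSum v = colSum fun i => A i *ᵥ v i := by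
  ext k
  change ∑ k', Matrix.blockDiagonal' A (finSigmaFinEquiv.symm k) (finSigmaFinEquiv.symm k') *
    v (finSigmaFinEquiv.symm k').1 (finSigmaFinEquiv.symm k').2 = _
  rw [Equiv.sum_comp finSigmaFinEquiv.symm
    (fun k' => Matrix.blockDiagonal' A (finSigmaFinEquiv.symm k) k' * v k'.1 k'.2),
    Fintype.sum_sigma, Finset.sum_eq_single (finSigmaFinEquiv.symm k).1]
  · simp only [colSum, Matrix.mulVec, dotProduct]
    refine Finset.sum_congr rfl fun i _ => ?_
    rw [← Matrix.blockDiagonal'_apply_eq A]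
  · intro i _ hi
    refine Finset.sum_eq_zero fun i' _ => ?_
    have := Matrix.blockDiagonal'_apply_ne A (finSigmaFinEquiv.symm k).2 i' hi.symm
    rw [this, zero_mul]
  · simp

lemma colSum_dotProduct (v w : ∀ i, Fin (n i) → ℝ) :
    colSum v ⬝ᵥ colSum w = ∑ i, v i ⬝ᵥ w i := by
  simp only [dotProduct, colSum]
  rw [Equiv.sum_comp finSigmaFinEquiv.symm (fun k => v k.1 k.2 * w k.1 k.2), Fintype.sum_sigma]

lemma colSum_eq_zero_iff (v : ∀ i, Fin (n i) → ℝ) : colSum v = 0 ↔ ∀ i, v i = 0 := by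
  refine ⟨fun h i => funext fun k => ?_, fun h => funext fun k => ?_⟩
  · have h' : ∀ x : Σ i, Fin (n i), v x.1 x.2 = 0 := fun x => by
      obtain ⟨k', rfl⟩ := finSigmaFinEquiv.symm.surjective x
      exact congrFun h k'
    exact h' ⟨i, k⟩
  · simp [colSum, h]

lemma isSymm_diagHom {A : ∀ i, Matrix (Fin (n i)) (Fin (n i)) ℝ} (h : ∀ i, (A i).IsSymm) :
    (diagHom n A).IsSymm := by
  change (Matrix.reindex _ _ (Matrix.blockDiagonal' A))ᵀ = _
  rw [Matrix.transpose_reindex, Matrix.blockDiagonal'_transpose]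
  simp only [fun i => (h i).eq]
  rfl

lemma isSymmTuple_diagSum {X : ∀ i, MatTuple g (n i)} (h : ∀ i, IsSymmTuple (X i)) :
    IsSymmTuple (diagSum X) :=
  fun j => isSymm_diagHom fun i => h i j

lemma evalX_diagSum (q : NCPoly g) (X : ∀ i, MatTuple g (n i)) :
    evalX q (diagSum X) = diagHom n fun i => evalX q (X i) := by
  have : FreeAlgebra.lift ℝ (diagSum X) =
      (diagHom n).comp (AlgHom.pi fun i => FreeAlgebra.lift ℝ (X i)) := by
    refine FreeAlgebra.hom_ext (funext fun j => ?_)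
    simp only [Function.comp_apply, FreeAlgebra.lift_ι_apply, AlgHom.comp_apply, diagSum_eq]
    congr 1
    ext i : 1
    simp
  exact congrArg (fun f => f q) this

lemma evalXH_diagSum (q : NCPolyXH g) (X H : ∀ i, MatTuple g (n i)) :
    evalXH q (diagSum X) (diagSum H) = diagHom n fun i => evalXH q (X i) (H i) := by
  have : FreeAlgebra.lift ℝ (Sum.elim (diagSum X) (diagSum H)) =
      (diagHom n).comp (AlgHom.pi fun i => FreeAlgebra.lift ℝ (Sum.elim (X i) (H i))) := by
    refine FreeAlgebra.hom_ext (funext fun j => ?_)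
    rcases j with j | j <;>
    · simp only [Function.comp_apply, FreeAlgebra.lift_ι_apply, AlgHom.comp_apply, diagSum_eq,
        Sum.elim_inl, Sum.elim_inr]
      congr 1
      ext i : 1
      simp
  exact congrArg (fun f => f q) this

lemma evalX_diagSum_mulVec_eq_zero_iff (q : NCPoly g) (X : ∀ i, MatTuple g (n i))
    (v : ∀ i, Fin (n i) → ℝ) :
    evalX q (diagSum X) *ᵥ colSum v = 0 ↔ ∀ i, evalX q (X i) *ᵥ v i = 0 := by
  rw [evalX_diagSum, diagHom_mulVec, colSum_eq_zero_iff]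

/-- `diagSum` as a linear map. -/
def diagSumLin (g : ℕ) (n : Fin t → ℕ) :
    (∀ i, MatTuple g (n i)) →ₗ[ℝ] MatTuple g (∑ i, n i) where
  toFun := diagSum
  map_add' X Y := by
    ext j : 1
    exact map_add (diagHom n) (fun i => X i j) (fun i => Y i j)
  map_smul' c X := by
    ext j : 1
    exact map_smul (diagHom n) c (fun i => X i j)

lemma diagSumLin_injective : Function.Injective (diagSumLin g n) := by
  intro X Y h
  ext i j a b
  have h1 := congrFun h j
  have h2 : Matrix.blockDiagonal' (fun i => X i j) = Matrix.blockDiagonal' (fun i => Y i j) :=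
    (Matrix.reindex finSigmaFinEquiv finSigmaFinEquiv).injective h1
  exact congrFun (congrFun (congrFun (Matrix.blockDiagonal'_injective h2) i) a) b

lemma quadForm_diagSum (f : NCPolyXH g) (X H : ∀ i, MatTuple g (n i))
    (v : ∀ i, Fin (n i) → ℝ) :
    quadForm f (diagSum X) (colSum v) (diagSum H) = ∑ i, quadForm f (X i) (v i) (H i) := by
  rw [quadForm, evalXH_diagSum, diagHom_mulVec, colSum_dotProduct]
  rfl

/-- `c₊` is superadditive under direct sums. -/
lemma sum_cPos_le (p : NCPoly g) (X : ∀ i, MatTuple g (n i)) (v : ∀ i, Fin (n i) → ℝ) :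
    ∑ i, cPos p (X i) (v i) ≤ cPos p (diagSum X) (colSum v) := by
  choose W hW hdim using fun i => exists_finrank_eq_cPos p (X i) (v i)
  have hrank : Module.finrank ℝ (∀ i, W i) = ∑ i, cPos p (X i) (v i) := by
    rw [Module.finrank_pi_fintype]
    exact Finset.sum_congr rfl fun i _ => hdim i
  rw [← hrank]
  let f : (∀ i, W i) →ₗ[ℝ] MatTuple g (∑ i, n i) :=
    diagSumLin g n ∘ₗ LinearMap.pi fun i => (W i).subtype ∘ₗ LinearMap.proj i
  have hf : ∀ x, f x = diagSum fun i => (x i : MatTuple g (n i)) := fun _ => rfl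
  refine finrank_le_cPos f (fun x => ?_) (fun x hx => ?_) (fun x hx => ?_)
  · refine ⟨isSymmTuple_diagSum fun i => ((hW i).1 (x i).2).1, ?_⟩
    rw [hf, evalXH_diagSum, diagHom_mulVec, colSum_eq_zero_iff]
    exact fun i => ((hW i).1 (x i).2).2
  · have h0 : (fun i => (x i : MatTuple g (n i))) = 0 :=
      diagSumLin_injective (hx.trans (map_zero (diagSumLin g n)).symm)
    ext i : 2
    exact congrFun h0 i
  · rw [hf, quadForm_diagSum]
    obtain ⟨i, hi⟩ : ∃ i, x i ≠ 0 := by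
      by_contra! hc
      exact hx (funext hc)
    have hpos : ∀ i, x i ≠ 0 → 0 < quadForm (ncHessian p) (X i) (v i) (x i) := fun i hi =>
      (hW i).2 _ (x i).2 (by simpa using hi)
    refine Finset.sum_pos' (fun k _ => ?_) ⟨i, Finset.mem_univ _, hpos i hi⟩
    by_cases hk : x k = 0
    · have h0 := ((hW k).1 (x k).2).1
      rw [hk, quadForm]
      have : evalXH (ncHessian p) (X k) ((0 : W k) : MatTuple g (n k)) = 0 := by
        rw [ncHessian_eq_middleMatrix le_rfl]
        simp [evalXH_sum, evalXH_mul, evalXH_border]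
      rw [this]
      simp
    · exact (hpos k hk).le

end DirectSums

lemma wordMatrix_mulVec {d n : ℕ} (X : MatTuple g n) (v : Fin n → ℝ) (c : Words g d → ℝ) :
    wordMatrix d X v *ᵥ c = evalX (∑ w, c w • mon (letters w)) X *ᵥ v := by
  ext i
  simp only [evalX_sum, evalX_smul, Matrix.sum_mulVec, Matrix.smul_mulVec, Finset.sum_apply,
    Pi.smul_apply, smul_eq_mul]
  simp only [Matrix.mulVec, dotProduct, wordMatrix]
  exact Finset.sum_congr rfl fun w _ => mul_comm _ _

lemma coef_sum_words {d : ℕ} (c : Words g d → ℝ) (w : Words g d) :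
    coef (letters w) (∑ w', c w' • mon (letters w')) = c w := by
  simp [coef_mon, letters_injective.eq_iff]

lemma coef_sum_words_of_le {d : ℕ} (c : Words g d → ℝ) {u : List (Fin g)} (hu : d ≤ u.length) :
    coef u (∑ w', c w' • mon (letters w')) = 0 := by
  simp only [map_sum, map_smul, coef_mon]
  refine Finset.sum_eq_zero fun w _ => ?_
  rw [if_neg, smul_zero]
  rintro rfl
  exact absurd (length_letters_lt w) (not_lt.2 hu)

/-- If no nonzero polynomial of degree less than `d` vanishes on a set that respects direct sums,
then the words of length less than `d` are independent at a single point of the set: a point at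
which the space of relations is minimal has none, as direct sums intersect these spaces. -/
lemma exists_indepWords {S : GradedSet g} {d : ℕ} (hsum : RespectsDirectSums S)
    (hne : ∃ n, 1 ≤ n ∧ (S n).Nonempty)
    (hmin : ∀ q : NCPoly g, (∀ w : List (Fin g), d ≤ w.length → coef w q = 0) →
      VanishesOn q S → q = 0) :
    ∃ n, 1 ≤ n ∧ ∃ P ∈ S n, IndepWords d P.1 P.2 := by
  let 𝒦 : Set (Submodule ℝ (Words g d → ℝ)) := {K | ∃ n, 1 ≤ n ∧ ∃ P ∈ S n,
    LinearMap.ker (Matrix.toLin' (wordMatrix d P.1 P.2)) = K}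
  obtain ⟨n₀, hn₀, P₀, hP₀⟩ := hne
  obtain ⟨_, ⟨n, hn, P, hP, rfl⟩, hmini⟩ := wellFounded_lt.has_min 𝒦 ⟨_, n₀, hn₀, P₀, hP₀, rfl⟩
  refine ⟨n, hn, P, hP, fun c hc => ?_⟩
  have hvan : VanishesOn (∑ w, c w • mon (letters w)) S := by
    intro n' hn' P' hP'
    let R : Fin 2 → Σ n, MatTuple g n × (Fin n → ℝ) := ![⟨n, P⟩, ⟨n', P'⟩]
    have hR := hsum 2 (fun i => (R i).1) (fun i => (R i).2.1) (fun i => (R i).2.2) two_pos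
      (by rw [Fin.forall_fin_two]; exact ⟨hn, hn'⟩) (by rw [Fin.forall_fin_two]; exact ⟨hP, hP'⟩)
    have key : ∀ c', c' ∈ LinearMap.ker (Matrix.toLin' (wordMatrix d
        (diagSum fun i => (R i).2.1) (colSum fun i => (R i).2.2))) ↔
        c' ∈ LinearMap.ker (Matrix.toLin' (wordMatrix d P.1 P.2)) ∧
        evalX (∑ w, c' w • mon (letters w)) P'.1 *ᵥ P'.2 = 0 := fun c' => by
      simp only [LinearMap.mem_ker, Matrix.toLin'_apply, wordMatrix_mulVec]
      rw [evalX_diagSum_mulVec_eq_zero_iff, Fin.forall_fin_two]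
      rfl
    by_contra hcon
    refine hmini _ ⟨_, Nat.one_le_iff_ne_zero.2 ?_, _, hR, rfl⟩ ?_
    · rw [Fin.sum_univ_two]
      change n + n' ≠ 0
      omega
    · refine lt_of_le_of_ne (fun c' hc' => ((key c').1 hc').1) fun heq => hcon ?_
      refine ((key c).1 ?_).2
      rw [heq]
      exact hc
  have h0 := hmin _ (fun w hw => coef_sum_words_of_le c hw) hvan
  ext w
  rw [← coef_sum_words c w, h0, map_zero, Pi.zero_apply]

/-- Independence of words persists in the `t`-fold direct sum of a point. -/
lemma exists_indepWords_mul {S : GradedSet g} {d n : ℕ} (hsum : RespectsDirectSums S)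
    (hn : 1 ≤ n) {P : MatTuple g n × (Fin n → ℝ)} (hP : P ∈ S n) (hind : IndepWords d P.1 P.2)
    {t : ℕ} (ht : 1 ≤ t) : ∃ P' ∈ S (t * n), IndepWords d P'.1 P'.2 := by
  have hsz : ∑ _i : Fin t, n = t * n := by simp
  rw [← hsz]
  refine ⟨_, hsum t (fun _ => n) (fun _ => P.1) (fun _ => P.2) ht (fun _ => hn) (fun _ => hP),
    fun c hc => hind c ?_⟩
  rw [wordMatrix_mulVec] at hc ⊢
  exact (evalX_diagSum_mulVec_eq_zero_iff _ (fun _ : Fin t => P.1) (fun _ => P.2)).1 hc ⟨0, ht⟩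

lemma IsAdmissible.nonempty {p : NCPoly g} {S : GradedSet g} (h : IsAdmissible p S) {n : ℕ}
    (hn : 1 ≤ n) : (S n).Nonempty := by
  obtain ⟨P, hP⟩ := h.nonempty_one
  have hsz : ∑ _i : Fin n, 1 = n := by simp
  have := h.directSums n (fun _ => 1) (fun _ => P.1) (fun _ => P.2) hn (fun _ => one_pos)
    (fun _ => hP)
  rw [hsz.symm]
  exact ⟨_, this⟩

lemma IsAdmissible.neg {p : NCPoly g} {S : GradedSet g} (h : IsAdmissible p S) :
    IsAdmissible (-p) S where
  subset n hn P hP := by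
    refine ⟨(h.subset n hn hP).1, ?_⟩
    rw [evalX_neg, Matrix.neg_mulVec, (h.subset n hn hP).2, neg_zero]
  directSums := h.directSums
  nonempty_one := h.nonempty_one

lemma isCurvNeg_iff (p : NCPoly g) (S : GradedSet g) (C : ℝ) :
    IsCurvNeg p S C ↔ IsCurvPos (-p) S C := by
  simp only [IsCurvNeg, IsCurvPos, cNeg_eq_cPos_neg]

lemma IsCurvPos.unique {p : NCPoly g} {S : GradedSet g} {C C' : ℝ} (h : IsCurvPos p S C)
    (h' : IsCurvPos p S C') : C = C' := by
  obtain ⟨β, hβ, hC⟩ := h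
  obtain ⟨β', hβ', hC'⟩ := h'
  refine tendsto_nhds_unique hC (hC'.congr' ?_)
  filter_upwards [Filter.eventually_ge_atTop 1] with n hn
  exact (hβ' n hn).unique (hβ n hn)

/-- The limit `C₊(S)` exists, by superadditivity (Fekete's lemma), and is bounded by any `M` with
`c₊ⁿ ≤ n M`. -/
lemma exists_isCurvPos {p : NCPoly g} {S : GradedSet g} (h : IsAdmissible p S) {M : ℕ}
    (hM : ∀ n, ∀ X : MatTuple g n, IsSymmTuple X → ∀ v, cPos p X v ≤ n * M) :
    ∃ C, IsCurvPos p S C ∧ 0 ≤ C ∧ C ≤ M := by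
  -- the value at `0` is set by hand, as `S 0` is arbitrary and direct sums have no empty blocks
  let s : ℕ → ℕ := fun n => if n = 0 then 0 else sSup ((fun P => cPos p P.1 P.2) '' S n)
  have hs : ∀ n, 1 ≤ n → IsGreatest ((fun P => cPos p P.1 P.2) '' S n) (s n) := by
    intro n hn
    have hbdd : BddAbove ((fun P => cPos p P.1 P.2) '' S n) :=
      ⟨n * M, by rintro _ ⟨P, hP, rfl⟩; exact hM n P.1 (h.subset n hn hP).1 P.2⟩
    simp only [s, if_neg (Nat.one_le_iff_ne_zero.1 hn)]
    exact ⟨Nat.sSup_mem ((h.nonempty hn).image _) hbdd, fun x hx => le_csSup hbdd hx⟩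
  have hsM : ∀ n, s n ≤ n * M := by
    intro n
    rcases Nat.eq_zero_or_pos n with rfl | hn
    · simp [s]
    · obtain ⟨P, hP, he⟩ := (hs n hn).1
      rw [← he]
      exact hM n P.1 (h.subset n hn hP).1 P.2
  have hadd : ∀ m n, s m + s n ≤ s (m + n) := by
    intro m n
    rcases Nat.eq_zero_or_pos m with rfl | hm
    · simp [s]
    rcases Nat.eq_zero_or_pos n with rfl | hn
    · simp [s]
    obtain ⟨P, hP, he⟩ := (hs m hm).1
    obtain ⟨P', hP', he'⟩ := (hs n hn).1
    let R : Fin 2 → Σ n, MatTuple g n × (Fin n → ℝ) := ![⟨m, P⟩, ⟨n, P'⟩]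
    have hR := h.directSums 2 (fun i => (R i).1) (fun i => (R i).2.1) (fun i => (R i).2.2)
      two_pos (by rw [Fin.forall_fin_two]; exact ⟨hm, hn⟩)
      (by rw [Fin.forall_fin_two]; exact ⟨hP, hP'⟩)
    have hsup := sum_cPos_le p (fun i => (R i).2.1) (fun i => (R i).2.2)
    have hsz : ∑ i, (R i).1 = m + n := Fin.sum_univ_two _
    have hle := (hs (∑ i, (R i).1) (by omega)).2 ⟨_, hR, rfl⟩
    rw [Fin.sum_univ_two] at hsup
    calc s m + s n = cPos p P.1 P.2 + cPos p P'.1 P'.2 := by rw [← he, ← he']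
      _ ≤ _ := hsup
      _ ≤ _ := hle
      _ = _ := by rw [hsz]
  have hsub : Subadditive fun n => -(s n : ℝ) := fun m n => by
    have : (s m : ℝ) + s n ≤ s (m + n) := by exact_mod_cast hadd m n
    linarith
  have hle : ∀ n, (s n : ℝ) / n ≤ M := fun n => by
    rcases Nat.eq_zero_or_pos n with rfl | hn
    · simp
    · rw [div_le_iff₀ (by exact_mod_cast hn), mul_comm]
      exact_mod_cast hsM n
  have hlim := (hsub.tendsto_lim ⟨-M, by
    rintro _ ⟨n, rfl⟩
    have := hle n
    simp only [neg_div]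
    linarith⟩).neg
  have hβ : Filter.Tendsto (fun n => (s n : ℝ) / n) Filter.atTop (nhds (-hsub.lim)) := by
    simpa [neg_div] using hlim
  refine ⟨_, ⟨fun n => (s n : ℝ) / n, fun n hn => ?_, hβ⟩,
    ge_of_tendsto' hβ fun n => by positivity, le_of_tendsto' hβ hle⟩
  refine IsGreatest.isLUB ⟨?_, ?_⟩
  · obtain ⟨P, hP, he⟩ := (hs n hn).1
    exact ⟨P, hP, by simp only; rw [← he]⟩
  · rintro _ ⟨P, hP, rfl⟩
    have := (hs n hn).2 ⟨P, hP, rfl⟩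
    simp only
    gcongr

/-- The lower bound `μ₊(Z(0)) ≤ C₊(S)` when no nonzero polynomial of degree less than that of
`p` vanishes on `S`. -/
lemma card_le_of_isCurvPos {p : NCPoly g} {S : GradedSet g} {C : ℝ} (h : IsAdmissible p S)
    (hC : IsCurvPos p S C) {d : ℕ} (hd : ncDegree p ≤ d) (hd1 : 1 ≤ d) {u : List (Fin g)}
    (hu : u.length = d) (hu0 : coef u p ≠ 0)
    (hmin : ∀ q : NCPoly g, q ≠ 0 → VanishesOn q S → d ≤ ncDegree q)
    {Q Q' : Matrix (BorderIdx g d) (BorderIdx g d) (NCPoly g)} {l : BorderIdx g d → ℝ}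
    (hsq : IsHessianSquares p Q l) (hQ : Q * Q' = 1) :
    (Fintype.card {k // 0 < l k} : ℝ) ≤ C := by
  obtain ⟨n, hn, P, hP, hind⟩ := exists_indepWords (d := d) h.directSums
    ⟨1, le_rfl, h.nonempty_one⟩
    (fun q hq hv => by
      by_contra hq0
      have h1 := hmin q hq0 hv
      have h2 : ncDegree q ≤ d - 1 := ncDegree_le_iff.2 fun w hw => hq w (by omega)
      omega)
  obtain ⟨β, hβ, hlim⟩ := hC
  set c₀ := g * Fintype.card (Words g d) ^ 2
  have hlow : ∀ t : ℕ, 1 ≤ t →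
      (Fintype.card {k // 0 < l k} : ℝ) - c₀ / (t * n : ℕ) ≤ β (t * n) := by
    intro t ht
    have htn : 1 ≤ t * n := Nat.mul_pos ht hn
    obtain ⟨P', hP', hind'⟩ := exists_indepWords_mul h.directSums hn hP hind ht
    have h1 := le_cPos_add hd hu hu0 hd1 hsq hQ (h.subset _ htn hP').1 hind'
    have h2 := (hβ _ htn).1 ⟨P', hP', rfl⟩
    refine le_trans ?_ h2
    have hpos : (0 : ℝ) < (t * n : ℕ) := by exact_mod_cast htn
    have h3 : ((t * n : ℕ) : ℝ) * Fintype.card {k // 0 < l k} ≤ cPos p P'.1 P'.2 + c₀ := by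
      exact_mod_cast h1
    rw [le_div_iff₀ hpos, sub_mul, div_mul_cancel₀ _ hpos.ne']
    linarith
  have htend : Filter.Tendsto (fun t : ℕ => t * n) Filter.atTop Filter.atTop :=
    Filter.tendsto_id.atTop_mul_const' hn
  have hlim2 : Filter.Tendsto
      (fun t : ℕ => (Fintype.card {k // 0 < l k} : ℝ) - c₀ / (t * n : ℕ)) Filter.atTop
      (nhds (Fintype.card {k // 0 < l k} - 0)) :=
    tendsto_const_nhds.sub ((tendsto_const_div_atTop_nhds_zero_nat _).comp htend)
  rw [sub_zero] at hlim2
  refine le_of_tendsto_of_tendsto hlim2 (hlim.comp htend) ?_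
  filter_upwards [Filter.eventually_ge_atTop 1] with t ht
  exact hlow t ht

end Sums

/-! ### The signature of `Z(0)` and the degree -/

section Degree

variable {g : ℕ}

/-- A subspace on which the form of `A = Oᵀ diag(l) O` is positive has dimension at most the
number of positive `l k`. -/
lemma finrank_le_card_pos {m : Type} [Fintype m] [DecidableEq m] {A O : Matrix m m ℝ}
    {l : m → ℝ} (hA : A = Oᵀ * Matrix.diagonal l * O) {E : Type*} [AddCommGroup E] [Module ℝ E]
    (f : E →ₗ[ℝ] (m → ℝ)) (hf : ∀ x, x ≠ 0 → 0 < f x ⬝ᵥ A *ᵥ f x) :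
    Module.finrank ℝ E ≤ Fintype.card {k // 0 < l k} := by
  have hform : ∀ c : m → ℝ, c ⬝ᵥ A *ᵥ c = ∑ k, l k * ((O *ᵥ c) k * (O *ᵥ c) k) := fun c => by
    rw [hA, ← Matrix.mulVec_mulVec, ← Matrix.mulVec_mulVec, Matrix.dotProduct_mulVec,
      Matrix.vecMul_transpose, dotProduct]
    simp only [Matrix.mulVec_diagonal]
    exact Finset.sum_congr rfl fun k _ => by ring
  have := finrank_le_of_sum_squares_pos (n := 1) l
    (fun k => LinearMap.pi fun _ => LinearMap.proj k ∘ₗ Matrix.toLin' O ∘ₗ f) (fun x hx => by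
      have := hf x hx
      rw [hform] at this
      simpa [dotProduct] using this)
  rwa [one_mul] at this

lemma exists_add_smul_pos {k : ℕ} (B : Matrix (Fin k) (Fin k) ℝ) :
    ∃ s : ℝ, ∀ x : Fin k → ℝ, x ≠ 0 → 0 < x ⬝ᵥ B *ᵥ x + s * (x ⬝ᵥ x) := by
  refine ⟨∑ a, ∑ b, |B a b| + 1, fun x hx => ?_⟩
  have hx0 : 0 < x ⬝ᵥ x := lt_of_le_of_ne (Finset.sum_nonneg fun i _ => mul_self_nonneg _)
    (Ne.symm fun h0 => hx (dotProduct_self_eq_zero.1 h0))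
  have hle : ∀ a, x a * x a ≤ x ⬝ᵥ x := fun a =>
    Finset.single_le_sum (f := fun i => x i * x i) (fun i _ => mul_self_nonneg _)
      (Finset.mem_univ a)
  have hB : -(∑ a, ∑ b, |B a b|) * (x ⬝ᵥ x) ≤ x ⬝ᵥ B *ᵥ x := by
    have hexp : x ⬝ᵥ B *ᵥ x = ∑ a, ∑ b, x a * (B a b * x b) := by
      simp only [dotProduct, Matrix.mulVec, Finset.mul_sum]
    rw [hexp, neg_mul, Finset.sum_mul, ← Finset.sum_neg_distrib]
    refine Finset.sum_le_sum fun a _ => ?_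
    rw [Finset.sum_mul, ← Finset.sum_neg_distrib]
    refine Finset.sum_le_sum fun b _ => ?_
    have h1 : |x a * (B a b * x b)| ≤ |B a b| * (x ⬝ᵥ x) := by
      rw [show x a * (B a b * x b) = B a b * (x a * x b) by ring, abs_mul]
      refine mul_le_mul_of_nonneg_left ?_ (abs_nonneg _)
      rw [abs_le]
      constructor <;> nlinarith [hle a, hle b, sq_nonneg (x a - x b), sq_nonneg (x a + x b)]
    exact (abs_le.1 h1).1
  linarith

/-- If `A` is symmetric, the span of the `e_{β a}` is isotropic and the pairing between the
`e_{α a}` and the `e_{β a}` is triangular and nondegenerate, then the form of `A` is positive on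
a subspace of dimension `k`: perturb the `e_{α a}` by large multiples of the basis dual to them
in the span of the `e_{β a}`. -/
lemma exists_pos_of_antitriangular {m : Type} [Fintype m] [DecidableEq m] {A : Matrix m m ℝ}
    (hA : A.IsSymm) {k : ℕ} (α β : Fin k → m) (hββ : ∀ a b, A (β a) (β b) = 0)
    (hαβ : ∀ a b, b < a → A (α a) (β b) = 0) (hdiag : ∀ a, A (α a) (β a) ≠ 0) :
    ∃ f : (Fin k → ℝ) →ₗ[ℝ] (m → ℝ), ∀ x, x ≠ 0 → 0 < f x ⬝ᵥ A *ᵥ f x := by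
  set T : Matrix (Fin k) (Fin k) ℝ := A.submatrix α β with hT
  have hdet : IsUnit T.det := by
    rw [Matrix.det_of_isUpperTriangular (M := T) (fun a b h => hαβ a b h), isUnit_iff_ne_zero]
    exact Finset.prod_ne_zero_iff.2 fun a _ => hdiag a
  obtain ⟨s, hs⟩ := exists_add_smul_pos (A.submatrix α α)
  let E : (Fin k → m) → Matrix m (Fin k) ℝ := fun γ =>
    Matrix.of fun i a => if i = γ a then 1 else 0
  have hE : ∀ γ δ : Fin k → m, (E γ)ᵀ * A * E δ = A.submatrix γ δ := fun γ δ => by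
    ext a b
    simp [Matrix.mul_apply, E]
  refine ⟨Matrix.toLin' (E α + (s / 2) • (E β * T⁻¹)), fun x hx => ?_⟩
  have hF : (E α + (s / 2) • (E β * T⁻¹))ᵀ * A * (E α + (s / 2) • (E β * T⁻¹)) =
      A.submatrix α α + s • (1 : Matrix (Fin k) (Fin k) ℝ) := by
    have h1 : (E α)ᵀ * A * (E β * T⁻¹) = 1 := by
      rw [← Matrix.mul_assoc, hE, ← hT, Matrix.mul_nonsing_inv _ hdet]
    have h2 : (E β * T⁻¹)ᵀ * A * E α = 1 := by
      rw [← Matrix.transpose_one, ← h1]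
      simp only [Matrix.transpose_mul, Matrix.transpose_transpose, hA.eq, Matrix.mul_assoc]
    have h3 : (E β * T⁻¹)ᵀ * A * (E β * T⁻¹) = 0 := by
      have hβ : A.submatrix β β = 0 := by ext a b; exact hββ a b
      rw [Matrix.transpose_mul, Matrix.mul_assoc, Matrix.mul_assoc, ← Matrix.mul_assoc A,
        ← Matrix.mul_assoc (E β)ᵀ, ← Matrix.mul_assoc (E β)ᵀ, hE, hβ]
      simp
    simp only [Matrix.transpose_add, Matrix.transpose_smul, Matrix.add_mul, Matrix.mul_add,
      Matrix.smul_mul, Matrix.mul_smul, h1, h2, h3, hE]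
    rw [smul_zero, add_zero, add_assoc, ← add_smul, add_halves]
  have hform : ∀ F : Matrix m (Fin k) ℝ,
      (F *ᵥ x) ⬝ᵥ A *ᵥ (F *ᵥ x) = x ⬝ᵥ (Fᵀ * A * F) *ᵥ x := fun F => by
    rw [Matrix.mul_assoc, ← Matrix.mulVec_mulVec, Matrix.dotProduct_mulVec x,
      Matrix.vecMul_transpose, ← Matrix.mulVec_mulVec]
  rw [Matrix.toLin'_apply, hform, hF, Matrix.add_mulVec, dotProduct_add, Matrix.smul_mulVec,
    Matrix.one_mulVec, dotProduct_smul, smul_eq_mul]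
  exact hs x hx

lemma exists_borderIdx {d : ℕ} {l : List (Fin g)} (h0 : 0 < l.length) (h : l.length ≤ d - 1) :
    ∃ I : BorderIdx g d, I.1 :: letters I.2 = l := by
  cases l with
  | nil => simp at h0
  | cons a l =>
    obtain ⟨w, hw⟩ := exists_letters (g := g) (l := l) (m := d - 1) (by simp at h; omega)
    exact ⟨(a, w), by rw [hw]⟩

/-- The degree bound `deg p ≤ 2 μ₊(Z(0)) + 2`: by its degree, `Z(0)` is block anti-triangular with
nonzero blocks on the anti-diagonal. -/
lemma le_two_mul_card_add_two {d : ℕ} {p : NCPoly g} (hp : star p = p) (hd : ncDegree p ≤ d)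
    {u : List (Fin g)} (hu : u.length = d) (hu0 : coef u p ≠ 0)
    {O : Matrix (BorderIdx g d) (BorderIdx g d) ℝ} {l : BorderIdx g d → ℝ}
    (hO : scalarPart (middleMatrix d p) = Oᵀ * Matrix.diagonal l * O) :
    d ≤ 2 * Fintype.card {k // 0 < l k} + 2 := by
  -- the cut of `u` after `a + 1` letters gives a nonzero entry `2 p_u` of `Z(0)`; the bound on `a`
  -- makes the second halves more than half as long as `u`, so they span an isotropic subspace
  have hα : ∀ a : Fin ((d - 1) / 2), ∃ I : BorderIdx g d,
      I.1 :: letters I.2 = (u.take (a + 1)).reverse := fun a =>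
    exists_borderIdx (by simp only [List.length_reverse, List.length_take]; omega)
      (by simp only [List.length_reverse, List.length_take]; omega)
  have hβ : ∀ a : Fin ((d - 1) / 2), ∃ I : BorderIdx g d,
      I.1 :: letters I.2 = u.drop (a + 1) := fun a =>
    exists_borderIdx (by rw [List.length_drop]; omega) (by rw [List.length_drop]; omega)
  choose α hα using hα
  choose β hβ using hβ
  obtain ⟨f, hf⟩ := exists_pos_of_antitriangular (isSymm_scalarPart_middleMatrix (d := d) hp) α β
    (fun a b => by
      rw [scalarPart_middleMatrix, hβ, hβ, coef_eq_zero_of_ncDegree_lt, mul_zero]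
      simp
      omega)
    (fun a b hab => by
      rw [scalarPart_middleMatrix, hα, hβ, coef_eq_zero_of_ncDegree_lt, mul_zero]
      simp
      omega)
    (fun a => by
      rw [scalarPart_middleMatrix, hα, hβ, List.reverse_reverse, List.take_append_drop]
      exact mul_ne_zero two_ne_zero hu0)
  have := finrank_le_card_pos hO f hf
  simp at this
  simp
  omega

end Degree

/-! ### Convexity and the Hessian -/

section Convexity

variable {g n : ℕ}

lemma hasDerivAt_evalXH (f : NCPolyXH g) (X H : MatTuple g n) (s : ℝ) (i j : Fin n) :
    HasDerivAt (fun s : ℝ => evalXH f (X + s • H) H i j)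
      (evalXH (dirDeriv f) (X + s • H) H i j) s := by
  refine FreeAlgebra.induction ℝ (Fin g ⊕ Fin g) (motive := fun f => ∀ i j,
    HasDerivAt (fun s : ℝ => evalXH f (X + s • H) H i j)
      (evalXH (dirDeriv f) (X + s • H) H i j) s) ?_ ?_ ?_ ?_ f i j
  · intro r i j
    simp only [dirDeriv_algebraMap]
    simpa [evalXH] using hasDerivAt_const s _
  · rintro (k | k) i j
    · rw [dirDeriv_inl]
      simpa [evalXH] using ((hasDerivAt_id s).mul_const (H k i j)).const_add (X k i j)
    · rw [dirDeriv_inr]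
      simpa [evalXH] using hasDerivAt_const s _
  · intro a b ha hb i j
    simp only [dirDeriv_mul, evalXH_add, evalXH_mul, Matrix.add_apply, Matrix.mul_apply,
      ← Finset.sum_add_distrib]
    exact HasDerivAt.fun_sum fun k _ => (ha i k).fun_mul (hb k j)
  · intro a b ha hb i j
    simp only [dirDeriv_add, evalXH_add, Matrix.add_apply]
    exact (ha i j).fun_add (hb i j)

lemma hasDerivAt_quadForm (f : NCPolyXH g) (X H : MatTuple g n) (v : Fin n → ℝ) (s : ℝ) :
    HasDerivAt (fun s : ℝ => quadForm f (X + s • H) v H)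
      (quadForm (dirDeriv f) (X + s • H) v H) s := by
  simp only [quadForm, dotProduct, Matrix.mulVec]
  exact HasDerivAt.fun_sum fun i _ => (HasDerivAt.fun_sum fun j _ =>
    (hasDerivAt_evalXH f X H s i j).mul_const _).mul_const _

lemma isSymmTuple_add_smul {X H : MatTuple g n} (hX : IsSymmTuple X) (hH : IsSymmTuple H)
    (s : ℝ) : IsSymmTuple (X + s • H) :=
  fun j => (hX j).add ((hH j).smul s)

lemma quadForm_inclX (p : NCPoly g) (X H : MatTuple g n) (v : Fin n → ℝ) :
    quadForm (inclX g p) X v H = (evalX p X *ᵥ v) ⬝ᵥ v := by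
  rw [quadForm, evalXH_inclX]

/-- The Hessian of a convex polynomial is nonnegative: it is the second derivative along lines. -/
lemma quadForm_hessian_nonneg_of_convex {p : NCPoly g} (h : IsMatrixConvex p)
    {X H : MatTuple g n} (hX : IsSymmTuple X) (hH : IsSymmTuple H) (v : Fin n → ℝ) :
    0 ≤ quadForm (ncHessian p) X v H := by
  have hconv : ConvexOn ℝ Set.univ fun s : ℝ => quadForm (inclX g p) (X + s • H) v H := by
    refine ⟨convex_univ, fun a _ b _ α β hα hβ hab => ?_⟩
    obtain rfl : β = 1 - α := by linarith
    have hpsd := (h n (X + a • H) (X + b • H) (isSymmTuple_add_smul hX hH a)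
      (isSymmTuple_add_smul hX hH b) α hα (by linarith)).dotProduct_mulVec_nonneg v
    have hline : α • (X + a • H) + (1 - α) • (X + b • H) =
        X + (α • a + (1 - α) • b) • H := by
      simp only [smul_eq_mul]
      module
    rw [hline, star_trivial, dotProduct_comm, Matrix.sub_mulVec, Matrix.add_mulVec,
      Matrix.smul_mulVec, Matrix.smul_mulVec, sub_dotProduct, add_dotProduct, smul_dotProduct,
      smul_dotProduct] at hpsd
    simp only [quadForm_inclX]
    linarith
  have hder := hasDerivAt_quadForm (inclX g p) X H v
  have hmono := hconv.monotoneOn_deriv fun s _ => (hder s).differentiableAt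
  have hderiv : deriv (fun s : ℝ => quadForm (inclX g p) (X + s • H) v H) =
      fun s => quadForm (ncDeriv p) (X + s • H) v H := funext fun s => (hder s).deriv
  rw [hderiv, monotoneOn_univ] at hmono
  have := (hasDerivAt_quadForm (ncDeriv p) X H v 0).nonneg_of_monotone hmono
  rw [zero_smul, add_zero] at this
  exact this

lemma isMatrixConvex_of_quadForm_hessian_nonneg {p : NCPoly g} (hp : star p = p)
    (h : ∀ n, ∀ X H : MatTuple g n, IsSymmTuple X → IsSymmTuple H → ∀ v,
      0 ≤ quadForm (ncHessian p) X v H) : IsMatrixConvex p := by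
  intro n X Y hX hY t ht0 ht1
  have hsymm : ∀ {Z : MatTuple g n}, IsSymmTuple Z → (evalX p Z).IsSymm := fun hZ => by
    rw [Matrix.IsSymm, ← evalX_star p hZ, hp]
  have hH : IsSymmTuple (X - Y) := fun j => (hX j).sub (hY j)
  have hline : t • X + (1 - t) • Y = Y + t • (X - Y) := by module
  rw [hline]
  refine Matrix.PosSemidef.of_dotProduct_mulVec_nonneg ?_ fun v => ?_
  · rw [Matrix.IsHermitian, Matrix.conjTranspose_eq_transpose_of_trivial]
    exact (((hsymm hX).smul t).add ((hsymm hY).smul (1 - t))).sub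
      (hsymm (isSymmTuple_add_smul hY hH t))
  · have hder := hasDerivAt_quadForm (inclX g p) Y (X - Y) v
    have hder2 := hasDerivAt_quadForm (ncDeriv p) Y (X - Y) v
    have hderiv : deriv (fun s : ℝ => quadForm (inclX g p) (Y + s • (X - Y)) v (X - Y)) =
        fun s => quadForm (ncDeriv p) (Y + s • (X - Y)) v (X - Y) :=
      funext fun s => (hder s).deriv
    have hconv := convexOn_univ_of_deriv2_nonneg (fun s => (hder s).differentiableAt)
      (by rw [hderiv]; exact fun s => (hder2 s).differentiableAt) (fun s => by
        rw [Function.iterate_succ_apply, Function.iterate_one, hderiv, (hder2 s).deriv]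
        exact h n _ _ (isSymmTuple_add_smul hY hH s) hH v)
    have := hconv.2 (Set.mem_univ 1) (Set.mem_univ 0) ht0 (sub_nonneg.2 ht1)
      (add_sub_cancel _ _)
    simp only [quadForm_inclX, smul_eq_mul, mul_one, mul_zero, add_zero, one_smul, zero_smul,
      add_sub_cancel] at this
    rw [star_trivial, dotProduct_comm, Matrix.sub_mulVec, Matrix.add_mulVec,
      Matrix.smul_mulVec, Matrix.smul_mulVec, sub_dotProduct, add_dotProduct, smul_dotProduct,
      smul_dotProduct, smul_eq_mul, smul_eq_mul]
    linarith

lemma cPos_eq_zero_of_quadForm_nonpos {p : NCPoly g} {X : MatTuple g n} {v : Fin n → ℝ}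
    (h : ∀ H, IsSymmTuple H → quadForm (ncHessian p) X v H ≤ 0) : cPos p X v = 0 := by
  obtain ⟨W, ⟨hT, hW⟩, hdim⟩ := exists_finrank_eq_cPos p X v
  have : W = ⊥ := by
    rw [Submodule.eq_bot_iff]
    intro H hH
    by_contra hne
    exact (hW H hH hne).not_ge (h H (hT hH).1)
  rw [← hdim, this, finrank_bot]

/-- Words are independent at the vacuum vector of a truncated Fock space, for the symmetric
operators "creation plus annihilation of a letter on the left". -/
lemma exists_fock_indepWords (g : ℕ) {d : ℕ} (hd : 1 ≤ d) :
    ∃ n, 1 ≤ n ∧ ∃ P : MatTuple g n × (Fin n → ℝ), IsSymmTuple P.1 ∧ IndepWords d P.1 P.2 := by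
  let e := Fintype.equivFin (Words g d)
  let wd : Fin (Fintype.card (Words g d)) → List (Fin g) := fun a => letters (e.symm a)
  have hinj : Function.Injective wd := letters_injective.comp e.symm.injective
  let X : MatTuple g (Fintype.card (Words g d)) := fun j => Matrix.of fun a b =>
    if wd a = j :: wd b ∨ wd b = j :: wd a then 1 else 0
  let v : Fin (Fintype.card (Words g d)) → ℝ := fun a => if wd a = [] then 1 else 0
  -- `w(X) v` is the basis vector of `w` plus a combination of basis vectors of shorter words
  have key : ∀ w : List (Fin g), w.length < d → ∀ a, w.length ≤ (wd a).length →
      (evalX (mon w) X *ᵥ v) a = if wd a = w then 1 else 0 := by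
    intro w
    induction w with
    | nil =>
      intro _ a _
      rw [mon_nil, evalX_one, Matrix.one_mulVec]
    | cons j w ih =>
      intro hw a ha
      rw [List.length_cons] at hw ha
      have hX : evalX (FreeAlgebra.ι ℝ j) X = X j := by simp [evalX]
      rw [mon_cons, evalX_mul, hX, ← Matrix.mulVec_mulVec]
      have hterm : ∀ b, X j a b * (evalX (mon w) X *ᵥ v) b =
          if wd b = w ∧ wd a = j :: w then 1 else 0 := by
        intro b
        simp only [X, Matrix.of_apply]
        by_cases h1 : wd a = j :: wd b
        · have hlen := congrArg List.length h1
          rw [List.length_cons] at hlen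
          rw [if_pos (Or.inl h1), one_mul, ih (by omega) b (by omega), h1]
          simp
        · by_cases h2 : wd b = j :: wd a
          · have hlen := congrArg List.length h2
            rw [List.length_cons] at hlen
            have hbw : wd b ≠ w := fun h => by rw [h] at hlen; omega
            rw [ih (by omega) b (by omega), if_neg hbw, mul_zero, if_neg (fun h => hbw h.1)]
          · rw [if_neg (not_or.2 ⟨h1, h2⟩), zero_mul, if_neg]
            rintro ⟨rfl, h⟩
            exact h1 h
      simp only [Matrix.mulVec, dotProduct] at hterm ⊢
      rw [Finset.sum_congr rfl fun b _ => hterm b]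
      by_cases hc : wd a = j :: w
      · obtain ⟨w', hw'⟩ := exists_letters (g := g) (l := w) (m := d) (by omega)
        have hb : wd (e w') = w := by simp only [wd, Equiv.symm_apply_apply, hw']
        rw [Finset.sum_eq_single (e w'), if_pos ⟨hb, hc⟩, if_pos hc]
        · intro b _ hne
          exact if_neg fun h => hne (hinj (h.1.trans hb.symm))
        · simp
      · simp [hc]
  refine ⟨Fintype.card (Words g d), Fintype.card_pos_iff.2 ⟨⟨⟨0, hd⟩, Fin.elim0⟩⟩, (X, v),
    fun j => ?_, fun c hc => ?_⟩
  · ext a b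
    simp only [X, Matrix.transpose_apply, Matrix.of_apply, or_comm]
  · have hzero : ∀ k : ℕ, ∀ w : Words g d, d - (letters w).length = k → c w = 0 := by
      intro k
      induction k using Nat.strong_induction_on with
      | _ k ih =>
        intro w hw
        have hlw := length_letters_lt w
        have h0 := congrFun hc (e w)
        simp only [Matrix.mulVec, dotProduct, wordMatrix] at h0
        rw [Finset.sum_eq_single w] at h0
        · have hwd : wd (e w) = letters w := by simp only [wd, Equiv.symm_apply_apply]
          have := key (letters w) hlw (e w) (by rw [hwd])
          simp only [Matrix.mulVec, dotProduct] at this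
          rw [this, if_pos hwd, one_mul] at h0
          exact h0
        · intro w' _ hne
          have hwd : wd (e w) = letters w := by simp only [wd, Equiv.symm_apply_apply]
          by_cases hl : (letters w').length ≤ (letters w).length
          · have := key (letters w') (length_letters_lt w') (e w) (by rw [hwd]; exact hl)
            simp only [Matrix.mulVec, dotProduct] at this
            rw [this, if_neg, zero_mul]
            rw [hwd]
            exact fun h => hne (letters_injective h).symm
          · rw [ih (d - (letters w').length) (by omega) w' rfl, mul_zero]
        · simp
    exact funext fun w => hzero _ w rfl

end Convexity

/-! ### The signature and its consequences -/

section Conclusion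

variable {g : ℕ}

lemma ncDegree_neg (p : NCPoly g) : ncDegree (-p) = ncDegree p := by
  simp [ncDegree]

lemma star_neg_eq {p : NCPoly g} (hp : star p = p) : star (-p) = -p := by
  rw [star_neg, hp]

lemma card_neg_pos {ι : Type*} [Fintype ι] (l : ι → ℝ) :
    Fintype.card {k // 0 < (-l) k} = Fintype.card {k // l k < 0} :=
  Fintype.card_congr (Equiv.subtypeEquivRight fun k => by simp)

/-- The Hessian as a weighted sum of squares whose weights have the signature of `Z(0)`. -/
lemma exists_isHessianSquares {p : NCPoly g} (hp : star p = p) :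
    ∃ (Q Q' : Matrix (BorderIdx g (ncDegree p)) (BorderIdx g (ncDegree p)) (NCPoly g))
      (l : BorderIdx g (ncDegree p) → ℝ), Q * Q' = 1 ∧ IsHessianSquares p Q l ∧
      muPos (scalarPart (middleMatrix (ncDegree p) p)) = Fintype.card {k // 0 < l k} ∧
      muNeg (scalarPart (middleMatrix (ncDegree p) p)) = Fintype.card {k // l k < 0} := by
  obtain ⟨Q, Q', l, hQ, hZ, hpos, hneg⟩ := exists_middleMatrix_eq_sum_squares hp le_rfl
  exact ⟨Q, Q', l, hQ, isHessianSquares_of_middleMatrix le_rfl hZ, hpos, hneg⟩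

lemma ncDegree_le_mu {p : NCPoly g} (hp : star p = p) :
    ncDegree p ≤ 2 * muPos (scalarPart (middleMatrix (ncDegree p) p)) + 2 ∧
      ncDegree p ≤ 2 * muNeg (scalarPart (middleMatrix (ncDegree p) p)) + 2 := by
  rcases Nat.eq_zero_or_pos (ncDegree p) with h0 | h0
  · omega
  obtain ⟨u, hu, hu0⟩ := exists_coef_ne_zero_of_ncDegree_pos h0
  obtain ⟨O, l, -, hO, hpos, hneg⟩ :=
    exists_diagonalization (isSymm_scalarPart_middleMatrix (d := ncDegree p) hp)
  rw [hpos, hneg, ← card_neg_pos]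
  refine ⟨le_two_mul_card_add_two hp le_rfl hu hu0 hO,
    le_two_mul_card_add_two (p := -p) (O := O) (star_neg_eq hp) (ncDegree_neg p).le hu
      (by rwa [map_neg, neg_ne_zero]) ?_⟩
  have hA : scalarPart (middleMatrix (ncDegree p) (-p)) =
      -scalarPart (middleMatrix (ncDegree p) p) := by
    ext I J
    simp [scalarPart_middleMatrix]
  have hd : Matrix.diagonal (-l) = -Matrix.diagonal l := (Matrix.diagonal_neg l).symm
  rw [hA, hO, hd, Matrix.mul_neg, Matrix.neg_mul]

/-- `C₊(S)` is the number of positive weights. -/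
lemma isCurvPos_eq {p : NCPoly g} {S : GradedSet g} (h : IsAdmissible p S) {d : ℕ}
    (hd : ncDegree p ≤ d) (hlead : 1 ≤ d → ∃ u : List (Fin g), u.length = d ∧ coef u p ≠ 0)
    (hmin : ∀ q : NCPoly g, q ≠ 0 → VanishesOn q S → d ≤ ncDegree q)
    {Q Q' : Matrix (BorderIdx g d) (BorderIdx g d) (NCPoly g)} {l : BorderIdx g d → ℝ}
    (hsq : IsHessianSquares p Q l) (hQ : Q * Q' = 1) {C : ℝ} (hC : IsCurvPos p S C) :
    C = Fintype.card {k // 0 < l k} := by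
  obtain ⟨C', hC', h0, hle⟩ := exists_isCurvPos h (M := Fintype.card {k // 0 < l k})
    fun n X hX v => cPos_le hsq hX v
  rw [hC.unique hC']
  refine le_antisymm hle ?_
  rcases Nat.eq_zero_or_pos d with rfl | hd1
  · have : IsEmpty (BorderIdx g 0) := ⟨fun I => I.2.1.elim0⟩
    rw [Fintype.card_eq_zero]
    exact_mod_cast h0
  · obtain ⟨u, hu, hu0⟩ := hlead hd1
    exact card_le_of_isCurvPos h hC' hd hd1 hu hu0 hmin hsq hQ

/-- The values of both limits. -/
lemma curvature_eq_mu {p : NCPoly g} (hp : star p = p) {S : GradedSet g} (h : IsAdmissible p S)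
    (hmin : IsMinDegreeDefining 0 p S) :
    (∀ C, IsCurvPos p S C → C = muPos (scalarPart (middleMatrix (ncDegree p) p))) ∧
      ∀ C, IsCurvNeg p S C → C = muNeg (scalarPart (middleMatrix (ncDegree p) p)) := by
  obtain ⟨Q, Q', l, hQ, hsq, hpos, hneg⟩ := exists_isHessianSquares hp
  have hmin' : ∀ q : NCPoly g, q ≠ 0 → VanishesOn q S → ncDegree p ≤ ncDegree q :=
    fun q hq hv => by
      have := hmin.le_degree q hq hv
      omega
  rw [hpos, hneg, ← card_neg_pos]
  refine ⟨fun C hC => isCurvPos_eq h le_rfl exists_coef_ne_zero_of_ncDegree_pos hmin' hsq hQ hC,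
    fun C hC => isCurvPos_eq h.neg (ncDegree_neg p).le (fun h1 => ?_) hmin' hsq.neg hQ
      ((isCurvNeg_iff p S C).1 hC)⟩
  obtain ⟨u, hu, hu0⟩ := exists_coef_ne_zero_of_ncDegree_pos h1
  exact ⟨u, hu, by rwa [map_neg, neg_ne_zero]⟩

lemma isMatrixConvex_of_weights {d : ℕ} {p : NCPoly g} (hp : star p = p)
    {Q : Matrix (BorderIdx g d) (BorderIdx g d) (NCPoly g)} {l : BorderIdx g d → ℝ}
    (hsq : IsHessianSquares p Q l) (hl : Fintype.card {k // l k < 0} = 0) :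
    IsMatrixConvex p := by
  have hl' : ∀ k, 0 ≤ l k := fun k => by
    by_contra hk
    exact (Fintype.card_eq_zero_iff.1 hl).false ⟨k, not_le.1 hk⟩
  refine isMatrixConvex_of_quadForm_hessian_nonneg hp fun n X H hX hH v => ?_
  rw [quadForm_hessian hsq hX hH]
  exact Finset.sum_nonneg fun k _ => mul_nonneg (hl' k)
    (Finset.sum_nonneg fun i _ => mul_self_nonneg _)

/-- A convex polynomial has no negative curvature and degree at most two: otherwise a large direct
sum of a point with independent words would have negative directions. -/
lemma IsMatrixConvex.degree_le_two {p : NCPoly g} (hp : star p = p) (h : IsMatrixConvex p) :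
    ncDegree p ≤ 2 ∧
      ∀ (n : ℕ) (X : MatTuple g n) (v : Fin n → ℝ), IsSymmTuple X → cNeg p X v = 0 := by
  have hzero : ∀ (n : ℕ) (X : MatTuple g n) (v : Fin n → ℝ), IsSymmTuple X →
      cPos (-p) X v = 0 := fun n X v hX =>
    cPos_eq_zero_of_quadForm_nonpos fun H hH => by
      have := quadForm_hessian_nonneg_of_convex h hX hH v
      simpa [quadForm, ncHessian_neg, evalXH_neg, Matrix.neg_mulVec] using this
  refine ⟨?_, fun n X v hX => by rw [cNeg_eq_cPos_neg, hzero n X v hX]⟩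
  rcases Nat.eq_zero_or_pos (ncDegree p) with h0 | h0
  · omega
  obtain ⟨u, hu, hu0⟩ := exists_coef_ne_zero_of_ncDegree_pos h0
  obtain ⟨Q, Q', l, hQ, hsq, -, hneg⟩ := exists_isHessianSquares hp
  obtain ⟨n, hn, P, hP, hind⟩ := exists_fock_indepWords g h0
  set c₀ := g * Fintype.card (Words g (ncDegree p)) ^ 2 with hc₀
  let S : GradedSet g := fun _ => {P | IsSymmTuple P.1}
  -- more copies than the constant `c₀` in the lower bound can absorb
  obtain ⟨P', hP', hind'⟩ := exists_indepWords_mul (S := S) (t := c₀ + 1)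
    (fun t n X v _ _ hX => isSymmTuple_diagSum hX) hn hP hind (by omega)
  have hle := le_cPos_add (ncDegree_neg p).le hu (by rwa [map_neg, neg_ne_zero]) h0 hsq.neg hQ
    hP' hind'
  rw [hzero _ _ _ hP', card_neg_pos, ← hneg, zero_add, ← hc₀] at hle
  have hmu : muNeg (scalarPart (middleMatrix (ncDegree p) p)) = 0 := by
    by_contra hne
    have h1 : c₀ + 1 ≤ (c₀ + 1) * n * muNeg (scalarPart (middleMatrix (ncDegree p) p)) := by
      rw [mul_assoc]
      exact Nat.le_mul_of_pos_right _ (Nat.mul_pos hn (Nat.pos_of_ne_zero hne))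
    omega
  have := (ncDegree_le_mu hp).2
  omega

end Conclusion

end NCSignature

end

open NCSignature in
theorem theorem1p3 (g : ℕ) (p : NCPoly g) (hp : star p = p) :
    -- (A), (B), and the value of the signature
    (∀ S : GradedSet g, IsAdmissible p S →
      ∃ Cpos Cneg : ℝ, IsCurvPos p S Cpos ∧ IsCurvNeg p S Cneg ∧
        (IsMinDegreeDefining 0 p S →
          (ncDegree p : ℝ) ≤ 2 * Cpos + 2 ∧
          (ncDegree p : ℝ) ≤ 2 * Cneg + 2 ∧
          (Cneg = 0 → IsMatrixConvex p ∧ ncDegree p ≤ 2) ∧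
          (Cpos = 0 → IsMatrixConcave p ∧ ncDegree p ≤ 2) ∧
          (∀ Z, IsMiddleMatrix p Z →
            Cpos = muPos (scalarPart Z) ∧ Cneg = muNeg (scalarPart Z)))) ∧
    (∃ Z, IsMiddleMatrix p Z) ∧
    -- (C)
    (IsMatrixConvex p → ncDegree p ≤ 2 ∧
      ∀ (n : ℕ) (X : MatTuple g n) (v : Fin n → ℝ), IsSymmTuple X → cNeg p X v = 0) ∧
    (IsMatrixConcave p → ncDegree p ≤ 2 ∧
      ∀ (n : ℕ) (X : MatTuple g n) (v : Fin n → ℝ), IsSymmTuple X → cPos p X v = 0) ∧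
    -- (D)
    (∀ S S' : GradedSet g, IsAdmissible p S → IsAdmissible p S' →
      IsMinDegreeDefining 0 p S → IsMinDegreeDefining 0 p S' →
      (∀ C C' : ℝ, IsCurvPos p S C → IsCurvPos p S' C' → C = C') ∧
      (∀ C C' : ℝ, IsCurvNeg p S C → IsCurvNeg p S' C' → C = C')) := by
  refine ⟨fun S hS => ?_, ⟨middleMatrix _ p, ncHessian_eq_middleMatrix le_rfl⟩,
    IsMatrixConvex.degree_le_two hp, fun h => ?_, fun S S' hS hS' hm hm' => ⟨?_, ?_⟩⟩
  · obtain ⟨Q, Q', l, hQ, hsq, hpos, hneg⟩ := exists_isHessianSquares hp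
    obtain ⟨Cpos, hCpos, -⟩ := exists_isCurvPos hS fun n X hX v => cPos_le hsq hX v
    obtain ⟨Cneg, hCneg, -⟩ := exists_isCurvPos hS.neg fun n X hX v => cPos_le hsq.neg hX v
    rw [← isCurvNeg_iff] at hCneg
    refine ⟨Cpos, Cneg, hCpos, hCneg, fun hm => ?_⟩
    obtain ⟨hP, hN⟩ := curvature_eq_mu hp hS hm
    rw [hP Cpos hCpos, hN Cneg hCneg]
    obtain ⟨hdP, hdN⟩ := ncDegree_le_mu hp
    refine ⟨by exact_mod_cast hdP, by exact_mod_cast hdN, fun h0 => ?_, fun h0 => ?_,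
      fun Z hZ => ?_⟩
    · have h1 := Nat.cast_eq_zero.1 h0
      exact ⟨isMatrixConvex_of_weights hp hsq (hneg.symm.trans h1), by omega⟩
    · have h1 := Nat.cast_eq_zero.1 h0
      refine ⟨isMatrixConvex_of_weights (star_neg_eq hp) hsq.neg ?_, by omega⟩
      rw [← card_neg_pos, neg_neg]
      exact hpos.symm.trans h1
    · rw [scalarPart_eq_of_hessian le_rfl Z hZ]
      exact ⟨rfl, rfl⟩
  · obtain ⟨h1, h2⟩ := IsMatrixConvex.degree_le_two (star_neg_eq hp) h
    rw [ncDegree_neg] at h1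
    refine ⟨h1, fun n X v hX => ?_⟩
    have := h2 n X v hX
    rwa [cNeg_eq_cPos_neg, neg_neg] at this
  · intro C C' hC hC'
    rw [(curvature_eq_mu hp hS hm).1 C hC, (curvature_eq_mu hp hS' hm').1 C' hC']
  · intro C C' hC hC'
    rw [(curvature_eq_mu hp hS hm).2 C hC, (curvature_eq_mu hp hS' hm').2 C' hC']
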